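/- **Configuration systems.** A configuration system consists of a set $\mathbb U$, a finite indexed family $S$ of $n=|S|$ subsets of $\mathbb U$ (the objects), a finite set $\mathcal F$ of configurations, each having a region $y\subseteq\mathbb U$ and a defining set $B_y\subseteq S$, and a conflict relation between configurations and objects such that $s$ conflicts with $(y,B_y)$ whenever $s\cap y\neq\emptyset$. For $H\subseteq S$ let $\mathcal F_0(H)$ be the set of configurations with $B_y\subseteq H$ that conflict with no $s\in H$. The system is complete if for every $H\subseteq S$ each point of $\mathbb U\setminus\bigcup H$ lies in the region of some member of $\mathcal F_0(H)$. Fix $b$ and $D$; we consider complete systems in which $|B_y|\le b$ for every configuration and every subset of $S$ is the defining set of at most $D$ configurations. **Multisets and $f$.** For multiplicities $m:S\to\mathbb N$, the multiset $S_m$ with $m(s)$ copies of each $s$ carries the configuration system whose configurations are those of $\mathcal F$ together with a chosen copy of each defining object; a copy of $s$ conflicts if $s$ conflicts with $(y,B_y)$, or if $s\in B_y$ and the copy precedes the chosen copy of $s$. Let $f(r)$ be the supremum, over all $m$ with $|S_m|\ge r$, of $\mathbf E|\mathcal F_0(R)|$, where $R\subseteq S_m$ is a uniformly random subset of size $r$.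 An $\varepsilon$-net of $S_m$ is a subset of $S_m$ that covers every point of $\mathbb U$ lying in at least $\varepsilon|S_m|$ members of $S_m$. **Net finders.** For a real number $A$, an $A$-net finder is a subroutine that, given $m$ and $r$ with $\max(1,2b)\le r\le |S_m|$, returns a $1/r$-net of $S_m$ with at most $A\max(1,f(r))$ elements; its answers and its running time may vary from call to call. **Theorem.** (i) There is a constant $A$, depending only on $b$ and $D$, such that every such system has an $A$-net finder, i.e. such nets exist for all these $m$ and $r$. (ii) There is a program $P$ (for a random access machine with unit-cost addition, truncated subtraction, indirect addressing, conditionals, loops, and calls of a net finder), depending only on $b$, and for all $D$ and $A$ there are constants $K$, $Q$ and a polynomial $q$, depending only on $b,D,A$, such that the following holds for every such system, every $\mathbb M\subseteq\mathbb U$ and every $A$-net finder. The input of $P$ is $n$ and the list, without repetition, of the incidence vectors $(\mathbf 1[p\in s])_{s\in S}$ of the points $p\in\mathbb M$. If $\mathbb M$ is covered by some $c$ objects of $S$ (the number $c$ is not part of the input), then $P$ halts and outputs a subfamily of $S$ that covers $\mathbb M$ and has at most $K\max(1,f(c))$ members. Its running time, the time spent in the net finder included, is at most $(T+1)\,q(n)$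 for every $T$ that bounds the time of each call of the net finder with $\max(1,2b)\le r\le Qc$ and $r\le|S_m|\le q(n)$. -/

import Mathlib

universe u v w

namespace GeomCover

/-- A configuration system with ground set `U` and objects `obj s`, `s : ι`.
An element `y : Region` is a configuration `(y, B_y)`: its point set is `carrier y`, the set of
objects that defines it is `defs y`, and `Conflict y s` says that `s` conflicts with it. -/
structure ConfigSystem (U : Type u) (ι : Type v) where
  obj : ι → Set U
  Region : Type w
  finite_region : Finite Region
  carrier : Region → Set U
  defs : Region → Finset ι
  Conflict : Region → ι → Prop
  conflict_of_meets : ∀ y s, (carrier y ∩ obj s).Nonempty → Conflict y s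

namespace ConfigSystem

variable {U : Type u} {ι : Type v}

/-- The `0`-regions of `H`: defined by objects of `H`, in conflict with no object of `H`. -/
def zeroRegions (C : ConfigSystem.{u, v, w} U ι) (H : Finset ι) : Set C.Region :=
  {y | C.defs y ⊆ H ∧ ∀ s ∈ H, ¬ C.Conflict y s}

/-- Every point outside the union of `H` lies in some `0`-region of `H`. -/
def IsComplete (C : ConfigSystem.{u, v, w} U ι) : Prop :=
  ∀ (H : Finset ι) (p : U), (∀ s ∈ H, p ∉ C.obj s) → ∃ y ∈ C.zeroRegions H, p ∈ C.carrier y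

/-- Every configuration is defined by at most `b` objects. -/
def DefinedByAtMost (C : ConfigSystem.{u, v, w} U ι) (b : ℕ) : Prop :=
  ∀ y, (C.defs y).card ≤ b

/-- Every set of objects defines at most `D` configurations. -/
def DefinesAtMost (C : ConfigSystem.{u, v, w} U ι) (D : ℕ) : Prop :=
  ∀ B : Finset ι, {y | C.defs y = B}.ncard ≤ D

/-- `H` covers `M`. -/
def IsCover (C : ConfigSystem.{u, v, w} U ι) (M : Set U) (H : Finset ι) : Prop :=
  ∀ p ∈ M, ∃ s ∈ H, p ∈ C.obj s

/-- `N` is an `ε`-net: it covers every point that lies in at least `ε |S|` objects. -/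
def IsNet [Fintype ι] (C : ConfigSystem.{u, v, w} U ι) (ε : ℝ) (N : Finset ι) : Prop :=
  ∀ p : U, ε * (Fintype.card ι : ℝ) ≤ ({s | p ∈ C.obj s}.ncard : ℝ) → ∃ s ∈ N, p ∈ C.obj s

/-- `E |F₀(R)|` for a uniformly random `R` of size `r` (meaningful for `r ≤ |S|`). -/
noncomputable def expZeroRegions [Fintype ι] (C : ConfigSystem.{u, v, w} U ι) (r : ℕ) : ℝ :=
  (∑ R ∈ (Finset.univ : Finset ι).powersetCard r, ((C.zeroRegions R).ncard : ℝ)) /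
    ((Fintype.card ι).choose r : ℝ)

/-- The elements of the multiset that has `m s` copies of each `s`. -/
abbrev Copy (m : ι → ℕ) : Type v := Σ s : ι, Fin (m s)

/-- The configuration system of the multiset with `m s` copies of each object `s`.
A configuration is one of `C` with a chosen copy of each of its defining objects. Ties between
copies are broken by index: a copy of a defining object that precedes the chosen one conflicts. -/
def copies (C : ConfigSystem.{u, v, w} U ι) (m : ι → ℕ) :
    ConfigSystem.{u, v, max v w} U (Copy m) where
  obj s := C.obj s.1
  Region := Σ y : C.Region, ((s : {s // s ∈ C.defs y}) → Fin (m s.1))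
  finite_region := by
    have := C.finite_region
    infer_instance
  carrier y := C.carrier y.1
  defs y := (C.defs y.1).attach.map
    ⟨fun s => ⟨s.1, y.2 s⟩, fun _ _ h => Subtype.ext (congrArg Sigma.fst h)⟩
  Conflict y s := C.Conflict y.1 s.1 ∨ ∃ h : s.1 ∈ C.defs y.1, s.2 < y.2 ⟨s.1, h⟩
  conflict_of_meets y s h := Or.inl (C.conflict_of_meets y.1 s.1 h)

/-- `f(r)`: the largest value of `E |F₀(R)|`, for a random `R` of size `r`, over all
multisets of at least `r` objects of `S`. (The values are at most `|Region|`.) -/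
noncomputable def f [Fintype ι] (C : ConfigSystem.{u, v, w} U ι) (r : ℕ) : ℝ :=
  ⨆ m : {m : ι → ℕ // r ≤ ∑ s, m s}, (C.copies m.1).expZeroRegions r

/-- `pts` lists without repetition the sets `{s | p ∈ s}` of the points `p ∈ M`. -/
def Lists {n : ℕ} (C : ConfigSystem.{u, 0, w} U (Fin n)) (M : Set U)
    (pts : List (Finset (Fin n))) : Prop :=
  pts.Nodup ∧ ∀ t, t ∈ pts ↔ ∃ p ∈ M, ∀ s, s ∈ t ↔ p ∈ C.obj s

end ConfigSystem

/-- A subroutine that builds nets. The `j`-th call, with multiplicities `m` and parameter `r`,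
where `max 1 (2 b) ≤ r ≤ |S'|`, returns a `1/r`-net of the multiset `S'` given by `m`, with at
most `A · max (1, f r)` elements, in time `cost j m r`. The answers may depend on `j`,
so that they may be outcomes of a randomized construction. -/
structure NetFinder {U : Type u} {n : ℕ} (C : ConfigSystem.{u, 0, w} U (Fin n))
    (b : ℕ) (A : ℝ) where
  find : ℕ → (m : Fin n → ℕ) → ℕ → Finset (ConfigSystem.Copy m)
  cost : ℕ → (Fin n → ℕ) → ℕ → ℕ
  isNet : ∀ j m r, 1 ≤ r → 2 * b ≤ r → r ≤ ∑ s, m s →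
    (C.copies m).IsNet (1 / (r : ℝ)) (find j m r)
  card_le : ∀ j m r, 1 ≤ r → 2 * b ≤ r → r ≤ ∑ s, m s →
    ((find j m r).card : ℝ) ≤ A * max 1 (C.f r)

/-- Structured programs for a random access machine with addition and truncated subtraction
(no multiplication), indirect addressing, and calls of a net-building subroutine. -/
inductive Com : Type
  | const (x k : ℕ)
  | add (x y z : ℕ)
  | sub (x y z : ℕ)
  | load (x y : ℕ)
  | store (x y : ℕ)
  | net (x y z : ℕ)
  | seq (p q : Com)
  | ifnz (x : ℕ) (p q : Com)
  | whilenz (x : ℕ) (p : Com)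

/-- Registers, memory, and the number of subroutine calls made so far. -/
structure Store : Type where
  reg : ℕ → ℕ
  mem : ℕ → ℕ
  calls : ℕ

namespace Store

def setReg (σ : Store) (x k : ℕ) : Store := { σ with reg := Function.update σ.reg x k }

def setMem (σ : Store) (a k : ℕ) : Store := { σ with mem := Function.update σ.mem a k }

/-- The multiplicities stored in the `n` cells from address `a` on. -/
def readMult (n : ℕ) (σ : Store) (a : ℕ) : Fin n → ℕ := fun s => σ.mem (a + s)

/-- Write the indicator vector of `N` to the `n` cells from address `a` on. -/
def writeSet {n : ℕ} (σ : Store) (a : ℕ) (N : Finset (Fin n)) : Store :=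
  { σ with
    mem := fun i =>
      if h : a ≤ i ∧ i - a < n then
        (if (⟨i - a, h.2⟩ : Fin n) ∈ N then 1 else 0)
      else σ.mem i
    calls := σ.calls + 1 }

/-- The set whose indicator vector is stored in the `n` cells from address `a` on. -/
def readSet (n : ℕ) (σ : Store) (a : ℕ) : Finset (Fin n) :=
  Finset.univ.filter fun s => σ.mem (a + s) ≠ 0

/-- The input: `n` and the number of points in registers `0` and `1`, and the incidence matrix of
points and objects in memory, row by row. -/
def input {n : ℕ} (pts : List (Finset (Fin n))) : Store where
  reg x := if x = 0 then n else if x = 1 then pts.length else 0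
  mem i :=
    if ∃ (j : Fin pts.length) (s : Fin n), i = j * n + s ∧ s ∈ pts.get j then 1 else 0
  calls := 0

/-- The output: the set stored at the address in register `2`. -/
def output (n : ℕ) (σ : Store) : Finset (Fin n) := σ.readSet n (σ.reg 2)

end Store

open Classical in
/-- `Exec F p σ σ' t`: from `σ`, the program `p` with net subroutine `F` halts in `σ'` in
time `t`. An elementary step takes time `1`; a call takes time `n + 1` for passing
the arguments, plus the time of the subroutine. -/
inductive Exec {U : Type u} {n : ℕ} {C : ConfigSystem.{u, 0, w} U (Fin n)} {b : ℕ} {A : ℝ}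
    (F : NetFinder C b A) : Com → Store → Store → ℕ → Prop
  | const (x k : ℕ) (σ : Store) : Exec F (.const x k) σ (σ.setReg x k) 1
  | add (x y z : ℕ) (σ : Store) :
      Exec F (.add x y z) σ (σ.setReg x (σ.reg y + σ.reg z)) 1
  | sub (x y z : ℕ) (σ : Store) :
      Exec F (.sub x y z) σ (σ.setReg x (σ.reg y - σ.reg z)) 1
  | load (x y : ℕ) (σ : Store) :
      Exec F (.load x y) σ (σ.setReg x (σ.mem (σ.reg y))) 1
  | store (x y : ℕ) (σ : Store) :
      Exec F (.store x y) σ (σ.setMem (σ.reg x) (σ.reg y)) 1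
  | net (x y z : ℕ) (σ : Store) :
      Exec F (.net x y z) σ
        (σ.writeSet (σ.reg z)
          ((F.find σ.calls (σ.readMult n (σ.reg x)) (σ.reg y)).image Sigma.fst))
        (F.cost σ.calls (σ.readMult n (σ.reg x)) (σ.reg y) + n + 1)
  | seq {p q : Com} {σ σ' σ'' : Store} {t t' : ℕ} :
      Exec F p σ σ' t → Exec F q σ' σ'' t' → Exec F (.seq p q) σ σ'' (t + t')
  | if_pos {x : ℕ} {p q : Com} {σ σ' : Store} {t : ℕ} :
      σ.reg x ≠ 0 → Exec F p σ σ' t → Exec F (.ifnz x p q) σ σ' (t + 1)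
  | if_neg {x : ℕ} {p q : Com} {σ σ' : Store} {t : ℕ} :
      σ.reg x = 0 → Exec F q σ σ' t → Exec F (.ifnz x p q) σ σ' (t + 1)
  | while_neg {x : ℕ} {p : Com} {σ : Store} :
      σ.reg x = 0 → Exec F (.whilenz x p) σ σ 1
  | while_pos {x : ℕ} {p : Com} {σ σ' σ'' : Store} {t t' : ℕ} :
      σ.reg x ≠ 0 → Exec F p σ σ' t → Exec F (.whilenz x p) σ' σ'' t' →
      Exec F (.whilenz x p) σ σ'' (t + t' + 1)

end GeomCover

namespace GeomCover
namespace ConfigSystem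

section Basic

variable {U : Type u} {ι : Type v}

/-- The `0`-regions of `H`, as a finite set. -/
noncomputable def zeroFinset (C : ConfigSystem.{u, v, w} U ι) (H : Finset ι) : Finset C.Region :=
  haveI := C.finite_region
  (Set.toFinite (C.zeroRegions H)).toFinset

theorem mem_zeroFinset {C : ConfigSystem.{u, v, w} U ι} {H : Finset ι} {y : C.Region} :
    y ∈ C.zeroFinset H ↔ C.defs y ⊆ H ∧ ∀ s ∈ H, ¬ C.Conflict y s := by
  simp [zeroFinset, zeroRegions]

theorem ncard_zeroRegions (C : ConfigSystem.{u, v, w} U ι) (H : Finset ι) :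
    (C.zeroRegions H).ncard = (C.zeroFinset H).card :=
  Set.ncard_eq_toFinset_card _ _

theorem ncard_defs_subset_le {C : ConfigSystem.{u, v, w} U ι} {b D : ℕ}
    (hb : C.DefinedByAtMost b) (hD : C.DefinesAtMost D) (H : Finset ι) :
    {y | C.defs y ⊆ H}.ncard ≤ D * (H.card + 1) ^ b := by
  classical
  have := C.finite_region
  have hsub : {y | C.defs y ⊆ H} ⊆
      ⋃ v ∈ (Finset.univ : Finset (Fin b → Option H)),
        {y | C.defs y = H.filter fun s => ∃ h : s ∈ H, ∃ i, v i = some ⟨s, h⟩} := by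
    intro y hy
    have hy' : C.defs y ⊆ H := hy
    let e := (C.defs y).equivFin
    refine Set.mem_biUnion (x := fun i : Fin b =>
      if h : (i : ℕ) < (C.defs y).card then some ⟨(e.symm ⟨i, h⟩).1, hy' (e.symm ⟨i, h⟩).2⟩
      else none) (by simp) ?_
    ext s
    simp only [Finset.mem_filter]
    constructor
    · intro hs
      refine ⟨hy' hs, hy' hs, ⟨e ⟨s, hs⟩, (e ⟨s, hs⟩).2.trans_le (hb y)⟩, ?_⟩
      simp
    · rintro ⟨_, h, i, hi⟩
      split_ifs at hi with hlt
      have := congrArg Subtype.val (Option.some.inj hi)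
      simp only at this
      rw [← this]
      exact (e.symm ⟨i, hlt⟩).2
  refine (Set.ncard_le_ncard hsub (Set.toFinite _)).trans
    ((Finset.set_ncard_biUnion_le _ _).trans ?_)
  refine (Finset.sum_le_sum fun v _ => hD _).trans ?_
  simp [mul_comm]

theorem card_zeroFinset_le {C : ConfigSystem.{u, v, w} U ι} {b D : ℕ}
    (hb : C.DefinedByAtMost b) (hD : C.DefinesAtMost D) (H : Finset ι) :
    (C.zeroFinset H).card ≤ D * (H.card + 1) ^ b := by
  have := C.finite_region
  rw [← ncard_zeroRegions]
  exact (Set.ncard_le_ncard (fun y hy => hy.1) (Set.toFinite _)).trans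
    (ncard_defs_subset_le hb hD H)

theorem card_zeroFinset_empty_le {C : ConfigSystem.{u, v, w} U ι} {D : ℕ}
    (hD : C.DefinesAtMost D) : (C.zeroFinset ∅).card ≤ D := by
  have := C.finite_region
  rw [← ncard_zeroRegions]
  exact (Set.ncard_le_ncard (fun y hy => Finset.subset_empty.mp hy.1) (Set.toFinite _)).trans
    (hD ∅)

/-- The objects that contain a point are those in conflict with some configuration. -/
theorem IsComplete.conflict_iff {C : ConfigSystem.{u, v, w} U ι} (hC : C.IsComplete)
    (t : Finset ι) [Fintype ι] [DecidableEq ι] {p : U} (hp : ∀ s, s ∈ t ↔ p ∈ C.obj s) :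
    ∃ y, ∀ s, s ∈ t ↔ C.Conflict y s := by
  obtain ⟨y, hy, hpy⟩ := hC tᶜ p fun s hs h => (Finset.mem_compl.mp hs) ((hp s).mpr h)
  refine ⟨y, fun s => ⟨fun hs => C.conflict_of_meets y s ⟨p, hpy, (hp s).mp hs⟩, fun h => ?_⟩⟩
  by_contra hs
  exact hy.2 s (Finset.mem_compl.mpr hs) h

theorem Lists.length_le {n b D : ℕ} {C : ConfigSystem.{u, 0, w} U (Fin n)} (hC : C.IsComplete)
    (hb : C.DefinedByAtMost b) (hD : C.DefinesAtMost D) {M : Set U}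
    {pts : List (Finset (Fin n))} (hpts : C.Lists M pts) :
    pts.length ≤ D * (n + 1) ^ b := by
  have := C.finite_region
  have hex : ∀ t : {t // t ∈ pts}, ∃ y, ∀ s, s ∈ t.1 ↔ C.Conflict y s := fun t => by
    obtain ⟨p, _, hp⟩ := (hpts.2 t.1).mp t.2
    exact hC.conflict_iff t.1 hp
  choose y hy using hex
  have hinj : Function.Injective y := fun t t' h =>
    Subtype.ext (Finset.ext fun s => by rw [hy, hy, h])
  have h1 := Nat.card_le_card_of_injective y hinj
  have h2 := ncard_defs_subset_le hb hD (Finset.univ : Finset (Fin n))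
  have h3 : Nat.card {t // t ∈ pts} = pts.length := by
    rw [← List.toFinset_card_of_nodup hpts.1]
    have := Nat.card_eq_card_toFinset {t | t ∈ pts}
    simp only [Set.coe_ofPred] at this
    rw [this]
    congr 1
    ext; simp
  simp only [Finset.subset_univ, Set.ofPred_true, Set.ncard_univ, Finset.card_univ,
    Fintype.card_fin] at h2
  omega

end Basic

section Copies

variable {U : Type u} {ι : Type v} [DecidableEq ι]

theorem mem_zeroRegions_copies {C : ConfigSystem.{u, v, w} U ι} {m : ι → ℕ}
    {R : Finset (Copy m)} {y : (C.copies m).Region} (hy : y ∈ (C.copies m).zeroRegions R) :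
    y.1 ∈ C.zeroFinset (R.image Sigma.fst) ∧ ∀ s, (⟨s.1, y.2 s⟩ : Copy m) ∈ R := by
  have hmem : ∀ s, (⟨s.1, y.2 s⟩ : Copy m) ∈ R := fun s =>
    hy.1 (Finset.mem_map.mpr ⟨s, Finset.mem_attach _ _, rfl⟩)
  refine ⟨mem_zeroFinset.mpr ⟨fun s hs => ?_, fun s hs h => ?_⟩, hmem⟩
  · exact Finset.mem_image.mpr ⟨_, hmem ⟨s, hs⟩, rfl⟩
  · obtain ⟨a, ha, rfl⟩ := Finset.mem_image.mp hs
    exact hy.2 a ha (Or.inl h)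

theorem ncard_zeroRegions_copies_le (C : ConfigSystem.{u, v, w} U ι) (m : ι → ℕ)
    (R : Finset (Copy m)) :
    ((C.copies m).zeroRegions R).ncard ≤ (C.zeroFinset (R.image Sigma.fst)).card := by
  rw [← Set.ncard_coe_finset]
  refine Set.ncard_le_ncard_of_injOn Sigma.fst
    (fun y hy => (mem_zeroRegions_copies hy).1) ?_ (Finset.finite_toSet _)
  rintro ⟨y, a⟩ hy ⟨y', a'⟩ hy' (rfl : y = y')
  have ha := (mem_zeroRegions_copies hy).2
  have ha' := (mem_zeroRegions_copies hy').2
  congr 1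
  funext s
  refine le_antisymm (not_lt.mp fun h => ?_) (not_lt.mp fun h => ?_)
  · exact hy.2 _ (ha' s) (Or.inr ⟨s.2, h⟩)
  · exact hy'.2 _ (ha s) (Or.inr ⟨s.2, h⟩)

/-- The `0`-regions of `H` are `0`-regions of unions of `b` pieces of a partition of `H`. -/
theorem card_zeroFinset_le_two_pow_mul {C : ConfigSystem.{u, v, w} U ι} {b q k : ℕ}
    (hb : C.DefinedByAtMost b) (hq : 0 < q) {H : Finset ι} (hH : H.card ≤ k * q) {G : ℕ}
    (hG : ∀ H' : Finset ι, H'.card ≤ q * b → (C.zeroFinset H').card ≤ G) :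
    (C.zeroFinset H).card ≤ 2 ^ k * G := by
  classical
  obtain ⟨idx, hinj, hlt⟩ : ∃ idx : ι → ℕ, Set.InjOn idx H ∧ ∀ s ∈ H, idx s < H.card := by
    refine ⟨fun s => if h : s ∈ H then H.equivFin ⟨s, h⟩ else 0, fun s hs s' hs' h => ?_,
      fun s hs => ?_⟩
    · simp only [Finset.mem_coe] at hs hs'
      simpa [hs, hs', Fin.val_inj] using h
    · simp [hs]
  let part : Finset ℕ → Finset ι := fun W => H.filter fun s => idx s / q ∈ W
  have hpart : ∀ W, (part W).card ≤ q * W.card := fun W => by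
    refine Finset.card_le_mul_card_image_of_maps_to
      (fun s hs => (Finset.mem_filter.mp hs).2) q fun w _ => ?_
    have : (Finset.Ico (w * q) (w * q + q)).card = q := by simp
    refine (Finset.card_le_card_of_injOn (t := Finset.Ico (w * q) (w * q + q)) idx
      (fun s hs => ?_) (hinj.mono fun s hs => ?_)).trans_eq this
    · have h := (Finset.mem_filter.mp hs).2
      subst h
      have := Nat.div_add_mod' (idx s) q
      have := Nat.mod_lt (idx s) hq
      simp only [Finset.coe_Ico, Set.mem_Ico]
      omega
    · exact (Finset.mem_filter.mp (Finset.mem_filter.mp hs).1).1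
  have hsub : C.zeroFinset H ⊆
      ((Finset.range k).powerset.filter fun W => W.card ≤ b).biUnion
        fun W => C.zeroFinset (part W) := by
    intro y hy
    obtain ⟨hy1, hy2⟩ := mem_zeroFinset.mp hy
    refine Finset.mem_biUnion.mpr ⟨(C.defs y).image fun s => idx s / q, ?_, ?_⟩
    · refine Finset.mem_filter.mpr ⟨Finset.mem_powerset.mpr fun i hi => ?_,
        Finset.card_image_le.trans (hb y)⟩
      obtain ⟨s, hs, rfl⟩ := Finset.mem_image.mp hi
      exact Finset.mem_range.mpr (Nat.div_lt_of_lt_mul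
        (((hlt s (hy1 hs)).trans_le hH).trans_eq (mul_comm _ _)))
    · exact mem_zeroFinset.mpr ⟨fun s hs => Finset.mem_filter.mpr
        ⟨hy1 hs, Finset.mem_image_of_mem _ hs⟩,
        fun s hs => hy2 s (Finset.mem_filter.mp hs).1⟩
  refine (Finset.card_le_card hsub).trans
    ((Finset.card_biUnion_le_card_mul _ _ G fun W hW => ?_).trans ?_)
  · exact hG _ ((hpart W).trans (Nat.mul_le_mul_left q (Finset.mem_filter.mp hW).2))
  · refine Nat.mul_le_mul_right G ((Finset.card_filter_le _ _).trans ?_)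
    simp

variable [Fintype ι]

theorem expZeroRegions_copies_le {C : ConfigSystem.{u, v, w} U ι} {m : ι → ℕ} {r : ℕ} {G : ℝ}
    (hG0 : 0 ≤ G) (hG : ∀ H : Finset ι, H.card ≤ r → ((C.zeroFinset H).card : ℝ) ≤ G) :
    (C.copies m).expZeroRegions r ≤ G := by
  refine div_le_of_le_mul₀ (Nat.cast_nonneg _) hG0 ?_
  refine (Finset.sum_le_card_nsmul _ _ G fun R hR => ?_).trans ?_
  · exact (Nat.cast_le.mpr (ncard_zeroRegions_copies_le C m R)).trans
      (hG _ (Finset.card_image_le.trans_eq (Finset.mem_powersetCard.mp hR).2))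
  · rw [Finset.card_powersetCard, nsmul_eq_mul, mul_comm, Finset.card_univ]

theorem f_le {C : ConfigSystem.{u, v, w} U ι} {r : ℕ} {G : ℝ} (hG0 : 0 ≤ G)
    (hG : ∀ H : Finset ι, H.card ≤ r → ((C.zeroFinset H).card : ℝ) ≤ G) : C.f r ≤ G :=
  Real.iSup_le (fun _ => expZeroRegions_copies_le hG0 hG) hG0

theorem card_zeroFinset_le_f (C : ConfigSystem.{u, v, w} U ι) {r : ℕ} {H : Finset ι}
    (hH : H.Nonempty) (hr : H.card ≤ r) : ((C.zeroFinset H).card : ℝ) ≤ C.f r := by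
  have := C.finite_region
  obtain ⟨s₀, hs₀⟩ := hH
  let m : ι → ℕ := fun s => (if s ∈ H then 1 else 0) + if s = s₀ then r - H.card else 0
  have hm : ∑ s, m s = r := by
    simp only [m, Finset.sum_add_distrib, Finset.sum_ite_mem, Finset.univ_inter,
      Finset.sum_const, smul_eq_mul, mul_one, Finset.sum_ite_eq', Finset.mem_univ, if_true]
    omega
  have hpos : ∀ s, s ∈ H → 0 < m s := fun s hs => by simp [m, hs]
  have hmem : ∀ a : Copy m, a.1 ∈ H := fun a => by
    by_contra hs
    have hne : a.1 ≠ s₀ := fun h => hs (h ▸ hs₀)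
    have := a.2.2
    simp [m, hs, hne] at this
  have hcard : Fintype.card (Copy m) = r := by simp [hm]
  have hexp : (C.copies m).expZeroRegions r =
      (((C.copies m).zeroRegions Finset.univ).ncard : ℝ) := by
    have h1 : (Finset.univ : Finset (Copy m)).powersetCard r = {Finset.univ} := by
      rw [← hcard, ← Finset.card_univ, Finset.powersetCard_self]
    rw [expZeroRegions, h1, hcard]
    simp
  have hbdd : BddAbove (Set.range fun m : {m : ι → ℕ // r ≤ ∑ s, m s} =>
      (C.copies m.1).expZeroRegions r) := by
    refine ⟨(Nat.card C.Region : ℝ), ?_⟩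
    rintro _ ⟨m', rfl⟩
    refine expZeroRegions_copies_le (Nat.cast_nonneg _) fun H' _ => Nat.cast_le.mpr ?_
    rw [← ncard_zeroRegions, ← Set.ncard_univ]
    exact Set.ncard_le_ncard (Set.subset_univ _)
  refine le_trans ?_ (le_ciSup hbdd ⟨m, hm.ge⟩)
  rw [hexp, Nat.cast_le, ← ncard_zeroRegions]
  have := (C.copies m).finite_region
  refine le_trans (Set.ncard_le_ncard ?_ (Set.toFinite _))
    (Set.ncard_image_le (f := Sigma.fst) (Set.toFinite _))
  intro y hy
  refine ⟨⟨y, fun s => ⟨0, hpos s.1 (hy.1 s.2)⟩⟩, ⟨Finset.subset_univ _, fun a _ => ?_⟩, rfl⟩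
  rintro (h | ⟨_, h⟩)
  · exact hy.2 _ (hmem a) h
  · exact absurd h (Nat.not_lt_zero _)

theorem card_zeroFinset_le_max {C : ConfigSystem.{u, v, w} U ι} {D r : ℕ}
    (hD : C.DefinesAtMost D) {H : Finset ι} (hr : H.card ≤ r) :
    ((C.zeroFinset H).card : ℝ) ≤ (D + 1) * max 1 (C.f r) := by
  have h1 : (1 : ℝ) ≤ max 1 (C.f r) := le_max_left _ _
  have h2 : C.f r ≤ max 1 (C.f r) := le_max_right _ _
  have h3 : (0 : ℝ) ≤ D := Nat.cast_nonneg _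
  rcases H.eq_empty_or_nonempty with rfl | hH
  · have : ((C.zeroFinset ∅).card : ℝ) ≤ D := Nat.cast_le.mpr (card_zeroFinset_empty_le hD)
    nlinarith
  · have := card_zeroFinset_le_f C hH hr
    nlinarith

theorem f_mul_le {C : ConfigSystem.{u, v, w} U ι} {b D : ℕ} (hb : C.DefinedByAtMost b)
    (hD : C.DefinesAtMost D) (Q c : ℕ) :
    max 1 (C.f (Q * c)) ≤
      (1 + D * (Q * b + 1) ^ b + 2 ^ (2 * b * Q) * (D + 1)) * max 1 (C.f c) := by
  have h1 : (1 : ℝ) ≤ max 1 (C.f c) := le_max_left _ _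
  have hx : (0 : ℝ) ≤ D * (Q * b + 1) ^ b := by positivity
  have hy : (0 : ℝ) ≤ 2 ^ (2 * b * Q) * (D + 1) := by positivity
  refine max_le (by nlinarith) (f_le (by positivity) fun H hH => ?_)
  by_cases h : b ≤ c ∧ b ≠ 0
  · obtain ⟨G, hG, hmax⟩ : ∃ G : ℕ, (∀ H' : Finset ι, H'.card ≤ c → (C.zeroFinset H').card ≤ G) ∧
        (G : ℝ) ≤ (D + 1) * max 1 (C.f c) := by
      refine ⟨⌊(D + 1) * max 1 (C.f c)⌋₊, fun H' hH' => ?_, Nat.floor_le (by positivity)⟩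
      exact Nat.le_floor (card_zeroFinset_le_max hD hH')
    have hb0 : 0 < b := Nat.pos_of_ne_zero h.2
    have hq : 0 < c / b := Nat.div_pos h.1 hb0
    have hcq : c ≤ 2 * b * (c / b) := by
      have := Nat.div_add_mod c b
      have := Nat.mod_lt c hb0
      nlinarith
    have h2 := card_zeroFinset_le_two_pow_mul (k := 2 * b * Q) (H := H) hb hq
      (hH.trans (by nlinarith)) fun H' hH' => hG H' (hH'.trans (Nat.div_mul_le_self c b))
    have h3 : ((C.zeroFinset H).card : ℝ) ≤ 2 ^ (2 * b * Q) * G := by exact_mod_cast h2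
    have h4 : (2 : ℝ) ^ (2 * b * Q) * G ≤ 2 ^ (2 * b * Q) * ((D + 1) * max 1 (C.f c)) := by gcongr
    nlinarith
  · have h2 : (C.zeroFinset H).card ≤ D * (Q * b + 1) ^ b := by
      refine (card_zeroFinset_le hb hD H).trans (Nat.mul_le_mul_left D ?_)
      rcases Nat.eq_zero_or_pos b with rfl | hb0
      · simp
      · have : c ≤ b := by omega
        exact Nat.pow_le_pow_left (by nlinarith) b
    have h3 : ((C.zeroFinset H).card : ℝ) ≤ D * (Q * b + 1) ^ b := by exact_mod_cast h2
    nlinarith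

theorem f_mono_max {C : ConfigSystem.{u, v, w} U ι} {D r r' : ℕ} (hD : C.DefinesAtMost D)
    (h : r ≤ r') : max 1 (C.f r) ≤ (D + 1) * max 1 (C.f r') := by
  have h1 : (1 : ℝ) ≤ max 1 (C.f r') := le_max_left _ _
  have h3 : (0 : ℝ) ≤ D := Nat.cast_nonneg _
  exact max_le (by nlinarith)
    (f_le (by positivity) fun H hH => card_zeroFinset_le_max hD (hH.trans h))

end Copies

end ConfigSystem
end GeomCover

namespace GeomCover
namespace ConfigSystem

section Sampling

variable {U : Type u} {ι : Type v} {α : Type*} [Fintype α]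

open Classical in
/-- The elements of a family of objects that are in conflict with `y`. -/
noncomputable def conflicts (C : ConfigSystem.{u, v, w} U ι) (π : α → ι) (y : C.Region) :
    Finset α :=
  Finset.univ.filter fun a => C.Conflict y (π a)

theorem mem_conflicts {C : ConfigSystem.{u, v, w} U ι} {π : α → ι} {y : C.Region} {a : α} :
    a ∈ C.conflicts π y ↔ C.Conflict y (π a) := by
  simp [conflicts]

/-- The proportion of the elements of a family of objects that are in conflict with `y`. -/
noncomputable def density (C : ConfigSystem.{u, v, w} U ι) (π : α → ι) (y : C.Region) : ℝ :=
  ((C.conflicts π y).card : ℝ) / (Fintype.card α : ℝ)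

theorem density_nonneg (C : ConfigSystem.{u, v, w} U ι) (π : α → ι) (y : C.Region) :
    0 ≤ C.density π y := by
  unfold density; positivity

theorem density_le_one (C : ConfigSystem.{u, v, w} U ι) (π : α → ι) (y : C.Region) :
    C.density π y ≤ 1 :=
  div_le_one_of_le₀ (Nat.cast_le.mpr (Finset.card_le_univ _)) (Nat.cast_nonneg _)

theorem one_sub_density_pow_le (C : ConfigSystem.{u, v, w} U ι) (π : α → ι) (y : C.Region)
    (q : ℕ) : (1 - C.density π y) ^ q ≤ Real.exp (-(q * C.density π y)) := by
  refine (pow_le_pow_left₀ (sub_nonneg.mpr (C.density_le_one π y))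
    (Real.one_sub_le_exp_neg _) q).trans_eq ?_
  rw [← Real.exp_nat_mul]
  congr 1; ring

/-- The number of samples of size `q` that avoid the conflicts of `y`. -/
theorem card_avoiding [Nonempty α] (C : ConfigSystem.{u, v, w} U ι) (π : α → ι) (y : C.Region)
    (q : ℕ) [DecidablePred fun ψ : Fin q → α => ∀ j, ¬ C.Conflict y (π (ψ j))] :
    (((Finset.univ : Finset (Fin q → α)).filter
      fun ψ => ∀ j, ¬ C.Conflict y (π (ψ j))).card : ℝ) =
      (Fintype.card α : ℝ) ^ q * (1 - C.density π y) ^ q := by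
  classical
  have h1 : ((Finset.univ : Finset (Fin q → α)).filter
      fun ψ => ∀ j, ¬ C.Conflict y (π (ψ j))) =
      Fintype.piFinset fun _ : Fin q => (C.conflicts π y)ᶜ := by
    ext ψ; simp [Fintype.mem_piFinset, mem_conflicts]
  have h0 : (Fintype.card α : ℝ) ≠ 0 := by simp
  rw [h1, Fintype.card_piFinset_const, Finset.card_compl, Nat.cast_pow,
    Nat.cast_sub (Finset.card_le_univ _), ← mul_pow, density]
  congr 1
  field_simp

variable [DecidableEq ι]

/-- A sample of `b + 1` blocks of size `q` for which the sum of `h` over the `0`-regions is at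
most a multiple of its expected value. A `0`-region is defined by objects from all but one
of the blocks, and the remaining block is unlikely to avoid a dense set of conflicts. -/
theorem exists_sample [Nonempty α] {C : ConfigSystem.{u, v, w} U ι} {b : ℕ}
    (hb : C.DefinedByAtMost b) (π : α → ι) (q : ℕ) {G c₀ : ℝ}
    (hG : ∀ H : Finset ι, H.card ≤ (b + 1) * q → ((C.zeroFinset H).card : ℝ) ≤ G)
    (h : C.Region → ℝ) (h0 : ∀ y, 0 ≤ h y) (hc : 0 ≤ c₀)
    (hh : ∀ y, (1 - C.density π y) ^ q * h y ≤ c₀) :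
    ∃ R : Finset α, R.card ≤ (b + 1) * q ∧
      ∑ y ∈ C.zeroFinset (R.image π), h y ≤ (b + 1) * (c₀ * G) := by
  classical
  set N : ℝ := (Fintype.card α : ℝ) with hN
  let im : (Fin (b + 1) → Fin q → α) → Finset α := fun φ =>
    Finset.univ.image fun x : Fin (b + 1) × Fin q => φ x.1 x.2
  let im' : ∀ k : Fin (b + 1), ({j // j ≠ k} → Fin q → α) → Finset α := fun k φ =>
    Finset.univ.image fun x : {j // j ≠ k} × Fin q => φ x.1 x.2
  have hcard' : ∀ k φ, ((im' k φ).image π).card ≤ (b + 1) * q := fun k φ => by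
    refine Finset.card_image_le.trans (Finset.card_image_le.trans ?_)
    rw [Finset.card_univ, Fintype.card_prod, Fintype.card_fin]
    refine Nat.mul_le_mul_right q ((Fintype.card_subtype_le _).trans ?_)
    simp
  have hmem : ∀ {φ : Fin (b + 1) → Fin q → α} {y : C.Region}, y ∈ C.zeroFinset ((im φ).image π) →
      ∀ k, (∀ s ∈ C.defs y, ∃ j i, j ≠ k ∧ π (φ j i) = s) →
      y ∈ C.zeroFinset ((im' k fun j => φ j.1).image π) := by
    intro φ y hy k hk
    obtain ⟨_, hy2⟩ := mem_zeroFinset.mp hy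
    refine mem_zeroFinset.mpr ⟨fun s hs => ?_, fun s hs => ?_⟩
    · obtain ⟨j, i, hj, rfl⟩ := hk s hs
      exact Finset.mem_image_of_mem π (Finset.mem_image.mpr ⟨(⟨j, hj⟩, i), Finset.mem_univ _, rfl⟩)
    · obtain ⟨a, ha, rfl⟩ := Finset.mem_image.mp hs
      obtain ⟨x, _, rfl⟩ := Finset.mem_image.mp ha
      exact hy2 _ (Finset.mem_image_of_mem π
        (Finset.mem_image.mpr ⟨(x.1.1, x.2), Finset.mem_univ _, rfl⟩))
  have hpt : ∀ φ : Fin (b + 1) → Fin q → α, ∑ y ∈ C.zeroFinset ((im φ).image π), h y ≤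
      ∑ k, ∑ y ∈ C.zeroFinset ((im' k fun j => φ j.1).image π),
        if ∀ i, ¬ C.Conflict y (π (φ k i)) then h y else 0 := by
    intro φ
    have hex : ∀ y ∈ C.zeroFinset ((im φ).image π), ∃ k,
        y ∈ C.zeroFinset ((im' k fun j => φ j.1).image π) ∧ ∀ i, ¬ C.Conflict y (π (φ k i)) := by
      intro y hy
      obtain ⟨hy1, hy2⟩ := mem_zeroFinset.mp hy
      have hw : ∀ s : {s // s ∈ C.defs y}, ∃ j i, π (φ j i) = s.1 := fun s => by
        obtain ⟨a, ha, hs⟩ := Finset.mem_image.mp (hy1 s.2)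
        obtain ⟨x, _, rfl⟩ := Finset.mem_image.mp ha
        exact ⟨x.1, x.2, hs⟩
      choose j i hji using hw
      obtain ⟨k, hk⟩ : ∃ k, k ∉ (C.defs y).attach.image j := by
        by_contra! hall
        have h1 : (Finset.univ : Finset (Fin (b + 1))).card ≤ _ :=
          Finset.card_le_card fun k _ => hall k
        have h2 := h1.trans (Finset.card_image_le.trans_eq Finset.card_attach)
        have := hb y
        simp at h2
        omega
      refine ⟨k, hmem hy k fun s hs => ⟨j ⟨s, hs⟩, i ⟨s, hs⟩, fun hjk => hk ?_, hji ⟨s, hs⟩⟩,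
        fun i => hy2 _ (Finset.mem_image_of_mem π
          (Finset.mem_image.mpr ⟨(k, i), Finset.mem_univ _, rfl⟩))⟩
      exact Finset.mem_image.mpr ⟨⟨s, hs⟩, Finset.mem_attach _ _, hjk⟩
    choose! k hk using hex
    have h1 : ∀ y ∈ C.zeroFinset ((im φ).image π), h y ≤ ∑ k',
        if y ∈ C.zeroFinset ((im' k' fun j => φ j.1).image π) ∧
          ∀ i, ¬ C.Conflict y (π (φ k' i)) then h y else 0 := fun y hy => by
      refine le_trans ?_ (Finset.single_le_sum (fun k' _ => ?_) (Finset.mem_univ (k y)))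
      · rw [if_pos (hk y hy)]
      · split_ifs; exacts [h0 y, le_rfl]
    refine (Finset.sum_le_sum h1).trans ?_
    rw [Finset.sum_comm]
    refine Finset.sum_le_sum fun k' _ => ?_
    rw [← Finset.sum_filter, ← Finset.sum_filter]
    refine Finset.sum_le_sum_of_subset_of_nonneg (fun y hy => ?_) fun y _ _ => h0 y
    exact Finset.mem_filter.mpr (Finset.mem_filter.mp hy).2
  have hblock : ∀ k : Fin (b + 1), ∑ φ : Fin (b + 1) → Fin q → α,
      ∑ y ∈ C.zeroFinset ((im' k fun j => φ j.1).image π),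
        (if ∀ i, ¬ C.Conflict y (π (φ k i)) then h y else 0) ≤
      (Fintype.card (Fin (b + 1) → Fin q → α) : ℝ) * (c₀ * G) := by
    intro k
    have he := (Equiv.funSplitAt k (Fin q → α)).sum_comp
      fun x : (Fin q → α) × ({j // j ≠ k} → Fin q → α) =>
        ∑ y ∈ C.zeroFinset ((im' k x.2).image π),
          if ∀ i, ¬ C.Conflict y (π (x.1 i)) then h y else 0
    rw [Fintype.card_congr (Equiv.funSplitAt k (Fin q → α)), Fintype.card_prod, Nat.cast_mul]
    refine (show _ = _ from he).trans_le ?_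
    rw [Fintype.sum_prod_type, Finset.sum_comm]
    have h2 : ∀ φ' ∈ (Finset.univ : Finset ({j // j ≠ k} → Fin q → α)),
        ∑ ψ : Fin q → α, ∑ y ∈ C.zeroFinset ((im' k φ').image π),
          (if ∀ i, ¬ C.Conflict y (π (ψ i)) then h y else 0) ≤ N ^ q * (c₀ * G) := by
      intro φ' _
      rw [Finset.sum_comm]
      have h3 : ∀ y ∈ C.zeroFinset ((im' k φ').image π), ∑ ψ : Fin q → α,
          (if ∀ i, ¬ C.Conflict y (π (ψ i)) then h y else 0) ≤ N ^ q * c₀ := by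
        intro y _
        rw [← Finset.sum_filter, Finset.sum_const, nsmul_eq_mul, card_avoiding, mul_assoc]
        exact mul_le_mul_of_nonneg_left (hh y) (by positivity)
      refine (Finset.sum_le_card_nsmul _ _ _ h3).trans ?_
      rw [nsmul_eq_mul]
      have h4 := hG _ (hcard' k φ')
      calc _ ≤ G * (N ^ q * c₀) := mul_le_mul_of_nonneg_right h4 (by positivity)
        _ = _ := by ring
    refine (Finset.sum_le_card_nsmul _ _ _ h2).trans_eq ?_
    rw [nsmul_eq_mul, Finset.card_univ]
    simp only [Fintype.card_pi, Finset.prod_const, Finset.card_univ, Fintype.card_fin, hN]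
    push_cast
    ring
  obtain ⟨φ, _, hφ⟩ := Finset.exists_le_of_sum_le
    (s := (Finset.univ : Finset (Fin (b + 1) → Fin q → α))) Finset.univ_nonempty
    (f := fun φ => ∑ y ∈ C.zeroFinset ((im φ).image π), h y)
    (g := fun _ => (b + 1) * (c₀ * G)) (by
      refine (Finset.sum_le_sum fun φ _ => hpt φ).trans ?_
      rw [Finset.sum_comm]
      refine (Finset.sum_le_card_nsmul _ _ _ fun k _ => hblock k).trans_eq ?_
      simp only [nsmul_eq_mul, Finset.sum_const, Finset.card_univ, Fintype.card_fin]
      push_cast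
      ring)
  refine ⟨im φ, Finset.card_image_le.trans_eq ?_, hφ⟩
  simp

end Sampling

end ConfigSystem
end GeomCover

namespace GeomCover
namespace ConfigSystem

section Nets

theorem exists_forall_mul_exp_neg_lt_one (b D : ℕ) : ∃ k : ℕ, 1 ≤ k ∧ ∀ x : ℝ, k ≤ x →
    (b + 1) * (Real.exp (-x) * (D * ((b + 2) * x ^ 2) ^ b)) < 1 := by
  have h := (Real.tendsto_pow_mul_exp_neg_atTop_nhds_zero (2 * b)).const_mul
    (((b : ℝ) + 1) * D * (b + 2) ^ b)
  rw [mul_zero] at h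
  obtain ⟨x₀, hx₀⟩ := Filter.eventually_atTop.mp (h.eventually (gt_mem_nhds one_pos))
  refine ⟨⌈x₀⌉₊ + 1, by omega, fun x hx => ?_⟩
  push_cast at hx
  refine lt_of_eq_of_lt ?_ (hx₀ x (by linarith [Nat.le_ceil x₀]))
  rw [mul_pow, ← pow_mul]
  ring

variable {U : Type u} {ι : Type v} {α : Type*} [Fintype α]

theorem card_mul_density (C : ConfigSystem.{u, v, w} U ι) (π : α → ι) [Nonempty α]
    (y : C.Region) : Fintype.card α * C.density π y = (C.conflicts π y).card := by
  have h0 : (Fintype.card α : ℝ) ≠ 0 := by simp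
  unfold density
  field_simp

theorem ncard_le_card_conflicts {C : ConfigSystem.{u, v, w} U ι} {π : α → ι} {y : C.Region}
    {p : U} (h : ∀ a, p ∈ C.obj (π a) → a ∈ C.conflicts π y) :
    {a | p ∈ C.obj (π a)}.ncard ≤ (C.conflicts π y).card := by
  rw [← Set.ncard_coe_finset]
  exact Set.ncard_le_ncard (fun a ha => h a ha) (Finset.finite_toSet _)

variable [DecidableEq ι]

theorem IsComplete.exists_mem_zeroFinset {C : ConfigSystem.{u, v, w} U ι} (hC : C.IsComplete)
    (π : α → ι) (R : Finset α) {p : U} (hp : ∀ a ∈ R, p ∉ C.obj (π a)) :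
    ∃ y ∈ C.zeroFinset (R.image π), ∀ a, p ∈ C.obj (π a) → a ∈ C.conflicts π y := by
  obtain ⟨y, hy, hpy⟩ := hC (R.image π) p fun s hs => by
    obtain ⟨a, ha, rfl⟩ := Finset.mem_image.mp hs
    exact hp a ha
  exact ⟨y, mem_zeroFinset.mpr hy,
    fun a ha => mem_conflicts.mpr (C.conflict_of_meets _ _ ⟨p, hpy, ha⟩)⟩

/-- Nets of quadratic size. -/
theorem exists_sq_net [Nonempty α] {C : ConfigSystem.{u, v, w} U ι} {b D k : ℕ}
    (hC : C.IsComplete) (hb : C.DefinedByAtMost b) (hD : C.DefinesAtMost D) (hk1 : 1 ≤ k)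
    (hk : ∀ x : ℝ, k ≤ x → (b + 1) * (Real.exp (-x) * (D * ((b + 2) * x ^ 2) ^ b)) < 1)
    (π : α → ι) {t : ℕ} (ht : 1 ≤ t) :
    ∃ N : Finset α, N.card ≤ (b + 1) * (k * t ^ 2) ∧
      ∀ p, Fintype.card α ≤ t * {a | p ∈ C.obj (π a)}.ncard → ∃ a ∈ N, p ∈ C.obj (π a) := by
  classical
  have hkt : (1 : ℝ) ≤ k * t := by exact_mod_cast Nat.mul_pos hk1 ht
  have hk1' : (1 : ℝ) ≤ k := by exact_mod_cast hk1
  have ht' : (1 : ℝ) ≤ t := by exact_mod_cast ht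
  obtain ⟨R, hR, hsum⟩ := exists_sample (C := C) hb π (k * t ^ 2)
    (G := D * ((b + 2) * ((k : ℝ) * t) ^ 2) ^ b) (c₀ := Real.exp (-(k * t)))
    (fun H hH => by
      have h1 : ((C.zeroFinset H).card : ℝ) ≤ D * (H.card + 1) ^ b := by
        exact_mod_cast card_zeroFinset_le hb hD H
      have h2 : (H.card : ℝ) ≤ (b + 1) * (k * t ^ 2) := by exact_mod_cast hH
      have h3 : (k : ℝ) * t ^ 2 ≤ (k * t) ^ 2 := by
        rw [mul_pow]; gcongr; nlinarith
      refine h1.trans ?_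
      gcongr
      nlinarith [Nat.cast_nonneg (α := ℝ) b])
    (fun y => if 1 ≤ t * C.density π y then 1 else 0) (fun y => by split_ifs <;> simp)
    (Real.exp_pos _).le
    (fun y => by
      split_ifs with hy
      · rw [mul_one]
        refine (C.one_sub_density_pow_le π y _).trans (Real.exp_le_exp.mpr ?_)
        push_cast
        nlinarith
      · rw [mul_zero]
        exact (Real.exp_pos _).le)
  refine ⟨R, hR, fun p hp => ?_⟩
  by_contra! hcov
  obtain ⟨y, hy, hcon⟩ := hC.exists_mem_zeroFinset π R hcov
  have h1 := Finset.single_le_sum (f := fun y => if 1 ≤ t * C.density π y then (1 : ℝ) else 0)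
    (fun y _ => by split_ifs <;> simp) hy
  have h2 : 1 ≤ t * C.density π y := by
    have h3 : (Fintype.card α : ℝ) ≤ t * (C.conflicts π y).card := by
      exact_mod_cast hp.trans (Nat.mul_le_mul_left t (ncard_le_card_conflicts hcon))
    have h4 : (0 : ℝ) < Fintype.card α := by simp [Fintype.card_pos]
    rw [density, ← mul_div_assoc, le_div_iff₀ h4, one_mul]
    exact h3
  simp only [h2, if_true] at h1
  exact absurd (h1.trans hsum) (not_le.mpr (hk _ (by nlinarith)))

/-- A net for the points all of whose objects conflict with `y`. -/
theorem exists_net_in_conflicts [Nonempty α] {C : ConfigSystem.{u, v, w} U ι} {b D k : ℕ}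
    (hC : C.IsComplete) (hb : C.DefinedByAtMost b) (hD : C.DefinesAtMost D) (hk1 : 1 ≤ k)
    (hk : ∀ x : ℝ, k ≤ x → (b + 1) * (Real.exp (-x) * (D * ((b + 2) * x ^ 2) ^ b)) < 1)
    (π : α → ι) {r : ℕ} (hr : 1 ≤ r) (y : C.Region) :
    ∃ N : Finset α, (N.card : ℝ) ≤ (b + 1) * k * (r * C.density π y + 1) ^ 2 ∧
      ∀ p, (∀ a, p ∈ C.obj (π a) → a ∈ C.conflicts π y) →
        Fintype.card α ≤ r * {a | p ∈ C.obj (π a)}.ncard → ∃ a ∈ N, p ∈ C.obj (π a) := by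
  classical
  have hα : 0 < Fintype.card α := Fintype.card_pos
  rcases (C.conflicts π y).eq_empty_or_nonempty with he | hne
  · refine ⟨∅, by simp only [Finset.card_empty, Nat.cast_zero]; positivity, fun p hcon hp => ?_⟩
    have h1 := ncard_le_card_conflicts hcon
    rw [he, Finset.card_empty] at h1
    rw [Nat.le_zero.mp h1] at hp
    omega
  · have hne' : Nonempty {a // a ∈ C.conflicts π y} := hne.to_subtype
    have hd : 0 < C.density π y := by
      have := hne.card_pos
      unfold density; positivity
    have hr' : (1 : ℝ) ≤ r := by exact_mod_cast hr
    have hpos : 0 < r * C.density π y := by positivity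
    obtain ⟨N, hN, hnet⟩ := exists_sq_net hC hb hD hk1 hk
      (fun a : {a // a ∈ C.conflicts π y} => π a.1) (t := ⌈r * C.density π y⌉₊)
      (Nat.one_le_ceil_iff.mpr hpos)
    refine ⟨N.map (Function.Embedding.subtype _), ?_, fun p hcon hp => ?_⟩
    · rw [Finset.card_map]
      have h1 : (N.card : ℝ) ≤ (b + 1) * (k * (⌈r * C.density π y⌉₊ : ℝ) ^ 2) := by
        exact_mod_cast hN
      refine h1.trans ?_
      rw [mul_assoc]
      gcongr
      exact (Nat.ceil_lt_add_one hpos.le).le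
    · have himg : {a | p ∈ C.obj (π a)}.ncard =
          {a : {a // a ∈ C.conflicts π y} | p ∈ C.obj (π a.1)}.ncard := by
        rw [← Set.ncard_image_of_injective _ Subtype.val_injective]
        congr 1
        ext a
        exact ⟨fun ha => ⟨⟨a, hcon a ha⟩, ha, rfl⟩, by rintro ⟨a, ha, rfl⟩; exact ha⟩
      obtain ⟨a, ha, hpa⟩ := hnet p (by
        rw [← himg, Fintype.card_coe, ← Nat.cast_le (α := ℝ), ← card_mul_density]
        have h1 : (Fintype.card α : ℝ) ≤ r * {a | p ∈ C.obj (π a)}.ncard := by exact_mod_cast hp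
        push_cast
        calc _ ≤ (r * {a | p ∈ C.obj (π a)}.ncard : ℝ) * C.density π y := by gcongr
          _ = r * C.density π y * {a | p ∈ C.obj (π a)}.ncard := by ring
          _ ≤ _ := by gcongr; exact Nat.le_ceil _)
      exact ⟨a.1, Finset.mem_map_of_mem _ ha, hpa⟩

/-- Nets of size `r + O(f(r))`. -/
theorem exists_net_add [Nonempty α] {C : ConfigSystem.{u, v, w} U ι} {b D k : ℕ}
    (hC : C.IsComplete) (hb : C.DefinedByAtMost b) (hD : C.DefinesAtMost D) (hk1 : 1 ≤ k)
    (hk : ∀ x : ℝ, k ≤ x → (b + 1) * (Real.exp (-x) * (D * ((b + 2) * x ^ 2) ^ b)) < 1)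
    (π : α → ι) {r q : ℕ} (hr : 1 ≤ r) (hrq : r ≤ 2 * (b + 1) * q) {G : ℝ}
    (hG : ∀ H : Finset ι, H.card ≤ (b + 1) * q → ((C.zeroFinset H).card : ℝ) ≤ G) :
    ∃ N : Finset α, (N.card : ℝ) ≤ (b + 1) * q + 16 * k * (b + 1) ^ 4 * G ∧
      ∀ p, Fintype.card α ≤ r * {a | p ∈ C.obj (π a)}.ncard → ∃ a ∈ N, p ∈ C.obj (π a) := by
  classical
  choose N hN hnet using fun y => exists_net_in_conflicts hC hb hD hk1 hk π hr y
  obtain ⟨R, hR, hsum⟩ := exists_sample (C := C) hb π q hG (c₀ := 16 * k * (b + 1) ^ 3)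
    (fun y => (b + 1) * k * (r * C.density π y + 1) ^ 2) (fun y => by positivity)
    (by positivity) (fun y => by
      have hd := C.density_nonneg π y
      have hr' : (r : ℝ) ≤ 2 * (b + 1) * q := by exact_mod_cast hrq
      set x := q * C.density π y with hx
      have hx0 : 0 ≤ x := by positivity
      have h1 : r * C.density π y + 1 ≤ 2 * (b + 1) * (x + 1) := by
        have : r * C.density π y ≤ 2 * (b + 1) * q * C.density π y := by gcongr
        have hb0 : (0 : ℝ) ≤ b := Nat.cast_nonneg b
        nlinarith
      have h2 : (x + 1) ^ 2 ≤ 4 * Real.exp x := by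
        have h3 := Real.add_one_le_exp (x / 2)
        have h4 : Real.exp x = Real.exp (x / 2) ^ 2 := by rw [← Real.exp_nat_mul]; congr 1; ring
        rw [h4]
        nlinarith
      calc _ ≤ Real.exp (-x) * ((b + 1) * k * (2 * (b + 1) * (x + 1)) ^ 2) := by
            have := C.one_sub_density_pow_le π y q
            gcongr
        _ = 4 * k * (b + 1) ^ 3 * ((x + 1) ^ 2 * Real.exp (-x)) := by ring
        _ ≤ 4 * k * (b + 1) ^ 3 * (4 * Real.exp x * Real.exp (-x)) := by gcongr
        _ = _ := by rw [mul_assoc 4 (Real.exp x), ← Real.exp_add]; simp; ring)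
  refine ⟨R ∪ (C.zeroFinset (R.image π)).biUnion N, ?_, fun p hp => ?_⟩
  · have h1 : ((R ∪ (C.zeroFinset (R.image π)).biUnion N).card : ℝ) ≤
        R.card + ∑ y ∈ C.zeroFinset (R.image π), ((N y).card : ℝ) := by
      exact_mod_cast (Finset.card_union_le _ _).trans
        (Nat.add_le_add_left Finset.card_biUnion_le _)
    have h2 : (R.card : ℝ) ≤ (b + 1) * q := by exact_mod_cast hR
    have h3 := (Finset.sum_le_sum fun y (_ : y ∈ C.zeroFinset (R.image π)) => hN y).trans hsum
    refine h1.trans (add_le_add h2 (h3.trans_eq ?_))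
    ring
  · by_cases hcov : ∃ a ∈ R, p ∈ C.obj (π a)
    · obtain ⟨a, ha, hpa⟩ := hcov
      exact ⟨a, Finset.mem_union_left _ ha, hpa⟩
    · push Not at hcov
      obtain ⟨y, hy, hcon⟩ := hC.exists_mem_zeroFinset π R hcov
      obtain ⟨a, ha, hpa⟩ := hnet y p hcon hp
      exact ⟨a, Finset.mem_union_right _ (Finset.mem_biUnion.mpr ⟨y, hy, ha⟩), hpa⟩

/-- If each object of a family has a point that lies in no other one, then the family has `O(f)`
members. -/
theorem card_le_of_private_points {C : ConfigSystem.{u, v, w} U ι} {b : ℕ}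
    (hC : C.IsComplete) (hb : C.DefinedByAtMost b) (π : α → ι) (p : α → U)
    (hp : ∀ a, p a ∈ C.obj (π a)) (hpriv : ∀ a a', a' ≠ a → p a ∉ C.obj (π a')) {G : ℝ}
    (hG1 : 1 ≤ G)
    (hG : ∀ H : Finset ι, H.card ≤ Fintype.card α → ((C.zeroFinset H).card : ℝ) ≤ G) :
    (Fintype.card α : ℝ) ≤ 8 * (b + 1) ^ 2 * G := by
  classical
  set n := Fintype.card α with hn
  have hdiv := Nat.div_add_mod n (2 * (b + 1))
  have hmod := Nat.mod_lt n (show 0 < 2 * (b + 1) by omega)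
  set q := n / (2 * (b + 1)) with hq
  have hb0 : (0 : ℝ) ≤ b := Nat.cast_nonneg b
  rcases Nat.eq_zero_or_pos q with hq0 | hq0
  · rw [hq0] at hdiv
    have h1 : (n : ℝ) ≤ 2 * (b + 1) := by exact_mod_cast (by omega : n ≤ 2 * (b + 1))
    nlinarith
  · have hn0 : 0 < n := by
      have := Nat.mul_pos (show 0 < 2 * (b + 1) by omega) hq0
      omega
    have : Nonempty α := Fintype.card_pos_iff.mp hn0
    have hq2 : 2 * ((b + 1) * q) ≤ n := by rw [← mul_assoc]; omega
    have hq4 : n ≤ 4 * (b + 1) * q := by nlinarith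
    have hq4' : (n : ℝ) ≤ 4 * (b + 1) * q := by exact_mod_cast hq4
    obtain ⟨R, hR, hsum⟩ := exists_sample (C := C) hb π q (G := G) (c₀ := 4 * (b + 1))
      (fun H hH => hG H (by omega)) (fun y => ((C.conflicts π y).card : ℝ))
      (fun y => by positivity) (by positivity) (fun y => by
        rw [← card_mul_density]
        have hd := C.density_nonneg π y
        set x := q * C.density π y with hx
        calc _ ≤ Real.exp (-x) * (4 * (b + 1) * q * C.density π y) := by
              have := C.one_sub_density_pow_le π y q
              gcongr
          _ = 4 * (b + 1) * (x * Real.exp (-x)) := by rw [hx]; ring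
          _ ≤ 4 * (b + 1) * (Real.exp x * Real.exp (-x)) := by
              gcongr
              linarith [Real.add_one_le_exp x]
          _ = _ := by rw [← Real.exp_add]; simp)
    have hsub : Rᶜ ⊆ (C.zeroFinset (R.image π)).biUnion (C.conflicts π) := fun a ha => by
      have ha' := Finset.mem_compl.mp ha
      obtain ⟨y, hy, hcon⟩ := hC.exists_mem_zeroFinset π R (p := p a)
        fun a' ha'' => hpriv a a' fun h => ha' (h ▸ ha'')
      exact Finset.mem_biUnion.mpr ⟨y, hy, hcon a (hp a)⟩
    have h1 := (Finset.card_le_card hsub).trans Finset.card_biUnion_le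
    rw [Finset.card_compl] at h1
    have h2 : n ≤ 2 * ∑ y ∈ C.zeroFinset (R.image π), (C.conflicts π y).card := by omega
    have h3 : (n : ℝ) ≤ 2 * ∑ y ∈ C.zeroFinset (R.image π), ((C.conflicts π y).card : ℝ) := by
      exact_mod_cast h2
    nlinarith

/-- Nets of size `O(f(r))`. -/
theorem exists_net [Fintype ι] [Nonempty α] {C : ConfigSystem.{u, v, w} U ι} {b D k : ℕ}
    (hC : C.IsComplete) (hb : C.DefinedByAtMost b) (hD : C.DefinesAtMost D) (hk1 : 1 ≤ k)
    (hk : ∀ x : ℝ, k ≤ x → (b + 1) * (Real.exp (-x) * (D * ((b + 2) * x ^ 2) ^ b)) < 1)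
    (π : α → ι) {r : ℕ} (hr : 1 ≤ r) (hrb : 2 * b ≤ r) :
    ∃ N : Finset α,
      (N.card : ℝ) ≤ (8 * (b + 1) ^ 2 + 16 * k * (b + 1) ^ 4) * (D + 1) * max 1 (C.f r) ∧
      ∀ p, Fintype.card α ≤ r * {a | p ∈ C.obj (π a)}.ncard → ∃ a ∈ N, p ∈ C.obj (π a) := by
  classical
  have hdiv := Nat.div_add_mod r (b + 1)
  have hmod := Nat.mod_lt r (show 0 < b + 1 by omega)
  set q := r / (b + 1) with hq
  have hq0 : 0 < q := Nat.div_pos (by omega) (by omega)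
  set G : ℝ := (D + 1) * max 1 (C.f r) with hGdef
  have hG : ∀ H : Finset ι, H.card ≤ r → ((C.zeroFinset H).card : ℝ) ≤ G :=
    fun H hH => card_zeroFinset_le_max hD hH
  have hG1 : 1 ≤ G := by
    have h1 : (1 : ℝ) ≤ max 1 (C.f r) := le_max_left _ _
    have h2 : (0 : ℝ) ≤ D := Nat.cast_nonneg D
    nlinarith
  obtain ⟨N₀, hN₀, hnet₀⟩ := exists_net_add (α := α) hC hb hD hk1 hk π (q := q) hr (by nlinarith)
    (fun H hH => hG H (by omega))
  let net : Finset α → Prop := fun N =>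
    ∀ p, Fintype.card α ≤ r * {a | p ∈ C.obj (π a)}.ncard → ∃ a ∈ N, p ∈ C.obj (π a)
  obtain ⟨N, hN, hmin⟩ := Finset.exists_min_image (N₀.powerset.filter net) Finset.card
    ⟨N₀, Finset.mem_filter.mpr ⟨Finset.mem_powerset_self _, hnet₀⟩⟩
  obtain ⟨hNsub, hNnet⟩ := Finset.mem_filter.mp hN
  have hpriv : ∀ a : {a // a ∈ N}, ∃ p, p ∈ C.obj (π a.1) ∧
      ∀ a' ∈ N, a' ≠ a.1 → p ∉ C.obj (π a') := by
    rintro ⟨a, ha⟩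
    have h1 : ¬ net (N.erase a) := fun h => by
      have h2 := hmin (N.erase a) (Finset.mem_filter.mpr ⟨Finset.mem_powerset.mpr
        ((Finset.erase_subset _ _).trans (Finset.mem_powerset.mp hNsub)), h⟩)
      have := Finset.card_erase_lt_of_mem ha
      omega
    simp only [net] at h1
    push Not at h1
    obtain ⟨p, hp, hnot⟩ := h1
    have hother : ∀ a' ∈ N, a' ≠ a → p ∉ C.obj (π a') :=
      fun a' ha' hne => hnot a' (Finset.mem_erase.mpr ⟨hne, ha'⟩)
    obtain ⟨a', ha', hpa'⟩ := hNnet p hp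
    by_cases h : a' = a
    · exact ⟨p, h ▸ hpa', hother⟩
    · exact absurd hpa' (hother a' ha' h)
  choose p hp hpp using hpriv
  obtain ⟨N', hN', hcard⟩ := Finset.exists_subset_card_eq (Nat.min_le_left N.card r)
  have h1 := card_le_of_private_points (α := {a // a ∈ N'}) hC hb (fun a => π a.1)
    (fun a => p ⟨a.1, hN' a.2⟩) (fun a => hp ⟨a.1, hN' a.2⟩)
    (fun a a' hne => hpp ⟨a.1, hN' a.2⟩ a'.1 (hN' a'.2) fun h => hne (Subtype.ext h)) hG1
    (fun H hH => hG H (by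
      rw [Fintype.card_coe] at hH
      omega))
  rw [Fintype.card_coe, hcard] at h1
  have h2 : (N.card : ℝ) ≤ N₀.card :=
    Nat.cast_le.mpr (Finset.card_le_card (Finset.mem_powerset.mp hNsub))
  have h3 : ((b : ℝ) + 1) * q ≤ r := by exact_mod_cast (by omega : (b + 1) * q ≤ r)
  have h4 : (0 : ℝ) ≤ 16 * k * (b + 1) ^ 4 * G := by positivity
  refine ⟨N, ?_, hNnet⟩
  have h5 : (N.card : ℝ) ≤ 8 * (b + 1) ^ 2 * G + 16 * k * (b + 1) ^ 4 * G := by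
    push_cast at h1
    rcases min_choice (N.card : ℝ) r with h | h <;> rw [h] at h1 <;> linarith
  calc _ ≤ _ := h5
    _ = _ := by rw [hGdef]; ring

end Nets

end ConfigSystem

theorem exists_netFinder (b D : ℕ) : ∃ A : ℝ, ∀ (U : Type u) (n : ℕ)
    (C : ConfigSystem.{u, 0, w} U (Fin n)), C.IsComplete → C.DefinedByAtMost b →
    C.DefinesAtMost D → Nonempty (NetFinder C b A) := by
  obtain ⟨k, hk1, hk⟩ := ConfigSystem.exists_forall_mul_exp_neg_lt_one b D
  refine ⟨(8 * (b + 1) ^ 2 + 16 * k * (b + 1) ^ 4) * (D + 1), fun U n C hC hb hD => ?_⟩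
  have hex : ∀ (m : Fin n → ℕ) (r : ℕ), ∃ N : Finset (ConfigSystem.Copy m),
      1 ≤ r → 2 * b ≤ r → r ≤ ∑ s, m s → (C.copies m).IsNet (1 / (r : ℝ)) N ∧
        (N.card : ℝ) ≤ (8 * (b + 1) ^ 2 + 16 * k * (b + 1) ^ 4) * (D + 1) * max 1 (C.f r) := by
    intro m r
    by_cases h : 1 ≤ r ∧ 2 * b ≤ r ∧ r ≤ ∑ s, m s
    · obtain ⟨h1, h2, h3⟩ := h
      have : Nonempty (ConfigSystem.Copy m) := Fintype.card_pos_iff.mp (by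
        rw [Fintype.card_sigma]; simp only [Fintype.card_fin]; omega)
      obtain ⟨N, hN, hnet⟩ := ConfigSystem.exists_net (α := ConfigSystem.Copy m) hC hb hD hk1 hk
        Sigma.fst h1 h2
      refine ⟨N, fun _ _ _ => ⟨fun p hp => hnet p ?_, hN⟩⟩
      have hr0 : (0 : ℝ) < r := by exact_mod_cast h1
      rw [one_div, inv_mul_le_iff₀ hr0] at hp
      exact_mod_cast hp
    · exact ⟨∅, fun h1 h2 h3 => absurd ⟨h1, h2, h3⟩ h⟩
  choose N hN using hex
  exact ⟨⟨fun _ m r => N m r, fun _ _ _ => 0, fun _ m r h1 h2 h3 => (hN m r h1 h2 h3).1,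
    fun _ m r h1 h2 h3 => (hN m r h1 h2 h3).2⟩⟩

end GeomCover

namespace GeomCover

section Logic

variable {U : Type u} {n : ℕ} {C : ConfigSystem.{u, 0, w} U (Fin n)} {b : ℕ} {A : ℝ}

/-- From `σ`, the program `P` halts in a state that satisfies `Post`, after a time that is at most
`(T + 1) * B` for all `T ∈ 𝒯`. -/
def Runs (F : NetFinder C b A) (𝒯 : Set ℕ) (P : Com) (σ : Store) (B : ℕ) (Post : Store → Prop) :
    Prop :=
  ∃ σ' t, Exec F P σ σ' t ∧ (∀ T ∈ 𝒯, t ≤ (T + 1) * B) ∧ Post σ'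

namespace Runs

variable {F : NetFinder C b A} {𝒯 : Set ℕ} {P Q : Com} {σ : Store} {B B' : ℕ}
  {Post Mid : Store → Prop}

theorem mono (h : Runs F 𝒯 P σ B Mid) (hB : B ≤ B') (hPost : ∀ σ', Mid σ' → Post σ') :
    Runs F 𝒯 P σ B' Post := by
  obtain ⟨σ', t, h1, h2, h3⟩ := h
  exact ⟨σ', t, h1, fun T hT => (h2 T hT).trans (Nat.mul_le_mul_left _ hB), hPost _ h3⟩

theorem of_step {σ' : Store} (h : Exec F P σ σ' 1) (hPost : Post σ') : Runs F 𝒯 P σ 1 Post :=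
  ⟨σ', 1, h, fun T _ => by omega, hPost⟩

theorem seq (h : Runs F 𝒯 P σ B Mid) (h' : ∀ σ', Mid σ' → Runs F 𝒯 Q σ' B' Post) :
    Runs F 𝒯 (.seq P Q) σ (B + B') Post := by
  obtain ⟨σ', t, h1, h2, h3⟩ := h
  obtain ⟨σ'', t', h1', h2', h3'⟩ := h' σ' h3
  exact ⟨σ'', t + t', .seq h1 h1', fun T hT => by
    rw [mul_add]; exact add_le_add (h2 T hT) (h2' T hT), h3'⟩

theorem step_seq {σ' : Store} (h : Exec F P σ σ' 1) (h' : Runs F 𝒯 Q σ' B Post) :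
    Runs F 𝒯 (.seq P Q) σ (B + 1) Post := by
  rw [add_comm]
  exact (of_step (Post := (· = σ')) h rfl).seq fun _ h => h ▸ h'

theorem const_seq {x k : ℕ} (h : Runs F 𝒯 Q (σ.setReg x k) B Post) :
    Runs F 𝒯 (.seq (.const x k) Q) σ (B + 1) Post := step_seq (.const ..) h

theorem add_seq {x y z : ℕ} (h : Runs F 𝒯 Q (σ.setReg x (σ.reg y + σ.reg z)) B Post) :
    Runs F 𝒯 (.seq (.add x y z) Q) σ (B + 1) Post := step_seq (.add ..) h

theorem sub_seq {x y z : ℕ} (h : Runs F 𝒯 Q (σ.setReg x (σ.reg y - σ.reg z)) B Post) :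
    Runs F 𝒯 (.seq (.sub x y z) Q) σ (B + 1) Post := step_seq (.sub ..) h

theorem load_seq {x y : ℕ} (h : Runs F 𝒯 Q (σ.setReg x (σ.mem (σ.reg y))) B Post) :
    Runs F 𝒯 (.seq (.load x y) Q) σ (B + 1) Post := step_seq (.load ..) h

theorem store_seq {x y : ℕ} (h : Runs F 𝒯 Q (σ.setMem (σ.reg x) (σ.reg y)) B Post) :
    Runs F 𝒯 (.seq (.store x y) Q) σ (B + 1) Post := step_seq (.store ..) h

theorem const {x k : ℕ} (h : Post (σ.setReg x k)) : Runs F 𝒯 (.const x k) σ 1 Post :=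
  of_step (.const ..) h

theorem add {x y z : ℕ} (h : Post (σ.setReg x (σ.reg y + σ.reg z))) :
    Runs F 𝒯 (.add x y z) σ 1 Post := of_step (.add ..) h

theorem sub {x y z : ℕ} (h : Post (σ.setReg x (σ.reg y - σ.reg z))) :
    Runs F 𝒯 (.sub x y z) σ 1 Post := of_step (.sub ..) h

theorem store {x y : ℕ} (h : Post (σ.setMem (σ.reg x) (σ.reg y))) :
    Runs F 𝒯 (.store x y) σ 1 Post := of_step (.store ..) h

open Classical in
theorem net {x y z : ℕ}
    (hcost : ∀ T ∈ 𝒯, F.cost σ.calls (σ.readMult n (σ.reg x)) (σ.reg y) ≤ T)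
    (h : Post (σ.writeSet (σ.reg z)
      ((F.find σ.calls (σ.readMult n (σ.reg x)) (σ.reg y)).image Sigma.fst))) :
    Runs F 𝒯 (.net x y z) σ (n + 2) Post :=
  ⟨_, _, .net .., fun T hT => by nlinarith [hcost T hT], h⟩

theorem ifnz {x : ℕ} (h : σ.reg x ≠ 0 → Runs F 𝒯 P σ B Post)
    (h' : σ.reg x = 0 → Runs F 𝒯 Q σ B Post) : Runs F 𝒯 (.ifnz x P Q) σ (B + 1) Post := by
  by_cases hx : σ.reg x = 0
  · obtain ⟨σ', t, h1, h2, h3⟩ := h' hx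
    exact ⟨σ', t + 1, .if_neg hx h1, fun T hT => by nlinarith [h2 T hT], h3⟩
  · obtain ⟨σ', t, h1, h2, h3⟩ := h hx
    exact ⟨σ', t + 1, .if_pos hx h1, fun T hT => by nlinarith [h2 T hT], h3⟩

/-- A loop with an invariant `I k` in which `k` decreases. -/
theorem whilenz {x : ℕ} {I : ℕ → Store → Prop}
    (hbody : ∀ k σ, I k σ → σ.reg x ≠ 0 → Runs F 𝒯 P σ B fun σ' => ∃ k' < k, I k' σ')
    (hPost : ∀ k σ, I k σ → σ.reg x = 0 → Post σ) {k : ℕ} (hI : I k σ) :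
    Runs F 𝒯 (.whilenz x P) σ (k * (B + 1) + 1) Post := by
  induction k using Nat.strong_induction_on generalizing σ with
  | _ k ih =>
    by_cases hx : σ.reg x = 0
    · exact ⟨σ, 1, .while_neg hx, fun T _ => Nat.succ_le_of_lt (by positivity), hPost k σ hI hx⟩
    · obtain ⟨σ', t, h1, h2, k', hk', hI'⟩ := hbody k σ hI hx
      obtain ⟨σ'', t', h1', h2', h3'⟩ := ih k' hk' hI'
      refine ⟨σ'', t + t' + 1, .while_pos hx h1 h1', fun T hT => ?_, h3'⟩
      have h3 := h2 T hT
      have h4 := h2' T hT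
      have h5 : (T + 1) * (k' * (B + 1) + 1 + (B + 1)) ≤ (T + 1) * (k * (B + 1) + 1) := by
        refine Nat.mul_le_mul_left _ ?_
        have := Nat.mul_le_mul_right (B + 1) (Nat.succ_le_of_lt hk')
        rw [Nat.succ_mul] at this
        omega
      nlinarith

/-- A loop that counts a register down from `N`. -/
theorem whilenz_count {x N : ℕ} {J : ℕ → Store → Prop}
    (hx : ∀ i σ, J i σ → σ.reg x = N - i)
    (hbody : ∀ i σ, i < N → J i σ → Runs F 𝒯 P σ B (J (i + 1))) (hJ : J 0 σ) :
    Runs F 𝒯 (.whilenz x P) σ (N * (B + 1) + 1) (J N) := by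
  refine whilenz (I := fun k σ => k ≤ N ∧ J (N - k) σ) (fun k σ h hne => ?_)
    (fun k σ h h0 => ?_) ⟨le_rfl, by simpa using hJ⟩
  · have h1 := hx _ _ h.2
    refine (hbody (N - k) σ (by omega) h.2).mono le_rfl fun σ' h' => ⟨k - 1, by omega, by omega, ?_⟩
    rwa [show N - (k - 1) = N - k + 1 by omega]
  · have h1 := hx _ _ h.2
    have h2 : N - k = N := by omega
    rw [← h2]
    exact h2.symm ▸ h.2

end Runs

end Logic

namespace Store

@[simp] theorem reg_setReg (σ : Store) (x k y : ℕ) :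
    (σ.setReg x k).reg y = if y = x then k else σ.reg y := by
  simp [setReg, Function.update_apply]

@[simp] theorem mem_setReg (σ : Store) (x k : ℕ) : (σ.setReg x k).mem = σ.mem := rfl

@[simp] theorem reg_setMem (σ : Store) (a k : ℕ) : (σ.setMem a k).reg = σ.reg := rfl

@[simp] theorem mem_setMem (σ : Store) (a k i : ℕ) :
    (σ.setMem a k).mem i = if i = a then k else σ.mem i := by
  simp [setMem, Function.update_apply]

theorem mem_writeSet_of_lt {n : ℕ} (σ : Store) {a i : ℕ} (N : Finset (Fin n)) (h : i < a) :
    (σ.writeSet a N).mem i = σ.mem i := by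
  have : ¬ (a ≤ i ∧ i - a < n) := by omega
  simp [writeSet, this]

theorem mem_writeSet_add {n : ℕ} (σ : Store) (a : ℕ) (N : Finset (Fin n)) (s : Fin n) :
    (σ.writeSet a N).mem (a + s) = if s ∈ N then 1 else 0 := by
  simp [writeSet]

theorem mem_readSet {n : ℕ} (σ : Store) (a : ℕ) (s : Fin n) :
    s ∈ σ.readSet n a ↔ σ.mem (a + s) ≠ 0 := by
  simp [readSet]

end Store

/-- The registers and the memory cells that the main loop does not change: in registers `0` to `8`
the number of objects, the number of points, the address of the net, the constant `1`, the
address of the weights, the largest total weight, and the constants `4`, `L` and `0`; in memory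
the incidence matrix `inc`. -/
structure Store.Base (n len L : ℕ) (inc : ℕ → ℕ) (σ : Store) : Prop where
  reg0 : σ.reg 0 = n
  reg1 : σ.reg 1 = len
  reg2 : σ.reg 2 = len * n + n
  reg3 : σ.reg 3 = 1
  reg4 : σ.reg 4 = len * n
  reg5 : σ.reg 5 = L * (n * n)
  reg6 : σ.reg 6 = 4
  reg7 : σ.reg 7 = L
  reg8 : σ.reg 8 = 0
  mem_eq : ∀ i < len * n, σ.mem i = inc i

namespace Store.Base

variable {n len L : ℕ} {inc : ℕ → ℕ} {σ : Store}

theorem of_eq {σ' : Store} (h : σ.Base n len L inc) (hreg : ∀ x < 9, σ'.reg x = σ.reg x)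
    (hmem : ∀ i < len * n, σ'.mem i = σ.mem i) : σ'.Base n len L inc where
  reg0 := (hreg 0 (by norm_num)).trans h.reg0
  reg1 := (hreg 1 (by norm_num)).trans h.reg1
  reg2 := (hreg 2 (by norm_num)).trans h.reg2
  reg3 := (hreg 3 (by norm_num)).trans h.reg3
  reg4 := (hreg 4 (by norm_num)).trans h.reg4
  reg5 := (hreg 5 (by norm_num)).trans h.reg5
  reg6 := (hreg 6 (by norm_num)).trans h.reg6
  reg7 := (hreg 7 (by norm_num)).trans h.reg7
  reg8 := (hreg 8 (by norm_num)).trans h.reg8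
  mem_eq i hi := (hmem i hi).trans (h.mem_eq i hi)

theorem setReg {x k : ℕ} (hx : 9 ≤ x) (h : σ.Base n len L inc) : (σ.setReg x k).Base n len L inc :=
  h.of_eq (fun y hy => by rw [reg_setReg, if_neg (by omega)]) fun _ _ => rfl

theorem setMem {a k : ℕ} (ha : len * n ≤ a) (h : σ.Base n len L inc) :
    (σ.setMem a k).Base n len L inc :=
  h.of_eq (fun _ _ => rfl) fun i hi => by rw [mem_setMem, if_neg (by omega)]

end Store.Base

/-! ### The program

The registers from `9` on hold: the total weight (`9`), the net parameter (`10`), whether some point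
is uncovered (`11`), the address of the current row (`12`), the number of rows left (`13`),
the address of the row of an uncovered point (`14`), whether the current point is covered (`15`),
the number of columns left (`16`), addresses of the current cells (`17`, `18`), and a loaded
value (`19`). -/

namespace Com

/-- `d := d + k * a`, `k := 0`. -/
def mulAdd (d a k : ℕ) : Com := .whilenz k (.seq (.add d d a) (.sub k k 3))

/-- Set all weights to `L`. -/
def resetWeights : Com :=
  .seq (.add 10 10 6) <| .seq (.const 9 0) <| .seq (.add 16 0 8) <| .seq (.add 17 4 8) <|
  .whilenz 16 <| .seq (.store 17 7) <| .seq (.add 9 9 7) <| .seq (.add 17 17 3) <|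
  .sub 16 16 3

/-- If the total weight is too large, increase the net parameter and reset the weights. -/
def checkWeight : Com :=
  .seq (.sub 19 9 5) <| .ifnz 19 resetWeights (.const 19 0)

/-- Process one entry of a row of the incidence matrix. -/
def scanCell : Com :=
  .seq (.load 19 18) <|
  .seq (.ifnz 19 (.seq (.load 19 17) (.ifnz 19 (.const 15 1) (.const 19 0))) (.const 19 0)) <|
  .seq (.add 17 17 3) <| .seq (.add 18 18 3) <| .sub 16 16 3

/-- Test whether a point is covered by the net. -/
def scanRow : Com :=
  .seq (.add 12 18 8) <| .seq (.const 15 0) <| .seq (.add 16 0 8) <| .seq (.add 17 2 8) <|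
  .seq (.whilenz 16 scanCell) <|
  .seq (.ifnz 15 (.const 19 0) (.seq (.const 11 1) (.add 14 12 8))) <| .sub 13 13 3

/-- Look for a point that is not covered by the net. -/
def scan : Com :=
  .seq (.const 11 0) <| .seq (.const 18 0) <| .seq (.add 13 1 8) <| .whilenz 13 scanRow

/-- Double the weight of one object if it contains the uncovered point. -/
def doubleCell : Com :=
  .seq (.load 19 18) <|
  .seq (.ifnz 19 (.seq (.load 19 17) <| .seq (.add 9 9 19) <| .seq (.add 19 19 19) <|
    .store 17 19) (.const 19 0)) <|
  .seq (.add 17 17 3) <| .seq (.add 18 18 3) <| .sub 16 16 3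

/-- Double the weights of the objects that contain the uncovered point, if there is one. -/
def double : Com :=
  .ifnz 11
    (.seq (.add 16 0 8) <| .seq (.add 17 4 8) <| .seq (.add 18 14 8) <| .whilenz 16 doubleCell)
    (.const 19 0)

/-- Find a net, and reweight. -/
def reweight : Com := .seq (.net 4 10 2) <| .seq scan double

/-- Set up the registers. -/
def setup (b L : ℕ) : Com :=
  .seq (.const 3 1) <|
  .seq (.add 19 1 8) <| .seq (mulAdd 4 0 19) <|
  .seq (.add 2 4 0) <|
  .seq (.add 19 0 8) <| .seq (mulAdd 18 0 19) <|
  .seq (.const 19 L) <| .seq (mulAdd 5 18 19) <|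
  .seq (.const 6 4) <| .seq (.const 7 L) <|
  .seq (.add 9 5 3) <| .seq (.const 10 (2 * b)) <| .add 11 1 8

/-- Reweight the objects until a net covers all points. -/
def cover (b : ℕ) : Com :=
  .seq (setup b (4 + 2 * b)) <| .whilenz 11 <| .seq checkWeight reweight

end Com

section Verification

variable {U : Type u} {n : ℕ} {C : ConfigSystem.{u, 0, w} U (Fin n)} {b : ℕ} {A : ℝ}
  {F : NetFinder C b A} {𝒯 : Set ℕ} {len L : ℕ} {inc : ℕ → ℕ}

theorem runs_mulAdd {d a k : ℕ} (hd3 : d ≠ 3) (hk3 : k ≠ 3) (hda : d ≠ a) (hdk : d ≠ k)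
    (hak : a ≠ k) {σ : Store} (h3 : σ.reg 3 = 1) :
    Runs F 𝒯 (.mulAdd d a k) σ (σ.reg k * 3 + 1) fun σ' =>
      σ' = (σ.setReg k 0).setReg d (σ.reg d + σ.reg k * σ.reg a) := by
  refine (Runs.whilenz_count (N := σ.reg k) (J := fun i σ' =>
    σ'.reg k = σ.reg k - i ∧ σ'.reg d = σ.reg d + i * σ.reg a ∧
      (∀ x, x ≠ k → x ≠ d → σ'.reg x = σ.reg x) ∧ σ'.mem = σ.mem ∧ σ'.calls = σ.calls)
    (fun i σ' h => h.1) (fun i σ' hi ⟨h1, h2, h4, h5, h6⟩ => ?_) (by simp)).mono le_rfl ?_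
  · refine Runs.add_seq (Runs.sub ⟨?_, ?_, fun x hxk hxd => ?_, h5, h6⟩)
    · simp [hdk.symm, hd3.symm, h1, h4 3 hk3.symm hd3.symm, h3]
      omega
    · simp [hdk, h2, h4 a hak hda.symm]
      ring
    · simp [hxk, hxd, h4 x hxk hxd]
  · rintro ⟨reg, mem, calls⟩ ⟨h1, h2, h4, h5, h6⟩
    simp only [Store.setReg, Store.mk.injEq]
    refine ⟨funext fun x => ?_, h5, h6⟩
    simp only [Function.update_apply]
    split_ifs with hxd hxk
    · rw [hxd]; exact h2
    · rw [hxk]; simpa using h1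
    · exact h4 x hxk hxd

theorem runs_setup {σ : Store} (h0 : σ.reg 0 = n) (h1 : σ.reg 1 = len)
    (hreg : ∀ x, 2 ≤ x → σ.reg x = 0) (hmem : ∀ i < len * n, σ.mem i = inc i) :
    Runs F 𝒯 (.setup b L) σ (len * 3 + n * 3 + L * 3 + 13) fun σ' => σ'.Base n len L inc ∧
      σ'.reg 9 = L * (n * n) + 1 ∧ σ'.reg 10 = 2 * b ∧ σ'.reg 11 = len ∧ σ'.mem = σ.mem := by
  have e : len * 3 + n * 3 + L * 3 + 13 =
      ((len * 3 + 1) + (((n * 3 + 1) + (((L * 3 + 1) + 5) + 1)) + 1 + 1)) + 1 + 1 := by omega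
  rw [e]
  refine Runs.const_seq (Runs.add_seq ?_)
  refine Runs.seq (B := len * 3 + 1) (B' := ((n * 3 + 1) + (((L * 3 + 1) + 5) + 1)) + 1 + 1)
    ((runs_mulAdd (by norm_num) (by norm_num) (by norm_num) (by norm_num)
    (by norm_num) (by simp)).mono (by simp [h1, hreg]) fun _ h => h) ?_
  rintro _ rfl
  refine Runs.add_seq (Runs.add_seq ?_)
  refine Runs.seq (B := n * 3 + 1) (B' := ((L * 3 + 1) + 5) + 1)
    ((runs_mulAdd (by norm_num) (by norm_num) (by norm_num) (by norm_num)
    (by norm_num) (by simp)).mono (by simp [h0, hreg]) fun _ h => h) ?_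
  rintro _ rfl
  refine Runs.const_seq ?_
  refine Runs.seq (B := L * 3 + 1) (B' := 5)
    ((runs_mulAdd (by norm_num) (by norm_num) (by norm_num) (by norm_num)
    (by norm_num) (by simp)).mono (by simp) fun _ h => h) ?_
  rintro _ rfl
  refine Runs.const_seq (Runs.const_seq (Runs.add_seq (Runs.const_seq (Runs.add ?_))))
  refine ⟨⟨?_, ?_, ?_, ?_, ?_, ?_, ?_, ?_, ?_, ?_⟩, ?_, ?_, ?_, ?_⟩
  all_goals simp [h0, h1, hreg]
  exact hmem

theorem runs_checkWeight {σ : Store} {W r : ℕ} {wt : ℕ → ℕ} (hσ : σ.Base n len L inc)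
    (h9 : σ.reg 9 = W) (h10 : σ.reg 10 = r)
    (hwt : W ≤ L * (n * n) → ∀ s < n, σ.mem (len * n + s) = wt s) :
    Runs F 𝒯 .checkWeight σ (n * 5 + 7) fun σ' => σ'.Base n len L inc ∧
      ((W ≤ L * (n * n) ∧ σ'.reg 9 = W ∧ σ'.reg 10 = r ∧ ∀ s < n, σ'.mem (len * n + s) = wt s) ∨
      (L * (n * n) < W ∧ σ'.reg 9 = L * n ∧ σ'.reg 10 = r + 4 ∧
        ∀ s < n, σ'.mem (len * n + s) = L)) := by
  refine Runs.sub_seq (Runs.ifnz (fun hne => ?_) fun heq => ?_)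
  · have hW : L * (n * n) < W := by simpa [h9, hσ.reg5, Nat.sub_eq_zero_iff_le] using hne
    refine Runs.add_seq (Runs.const_seq (Runs.add_seq (Runs.add_seq ?_)))
    refine (Runs.whilenz_count (N := n) (B := 4) (J := fun i σ' => σ'.reg 16 = n - i ∧
      σ'.Base n len L inc ∧ σ'.reg 9 = L * i ∧ σ'.reg 10 = r + 4 ∧ σ'.reg 17 = len * n + i ∧
      ∀ s < i, σ'.mem (len * n + s) = L) (fun i σ' h => h.1) ?_ ?_).mono le_rfl
      fun σ' h => ⟨h.2.1, Or.inr ⟨hW, h.2.2.1, h.2.2.2.1, h.2.2.2.2.2⟩⟩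
    · rintro i σ' hi ⟨h16, hB, g9, g10, g17, gm⟩
      refine Runs.store_seq (Runs.add_seq (Runs.add_seq (Runs.sub ⟨?_, ?_, ?_, ?_, ?_, ?_⟩)))
      · simp [h16, hB.reg3]; omega
      · exact (((hB.setMem (by omega)).setReg (by norm_num)).setReg (by norm_num)).setReg
          (by norm_num)
      · simp [g9, hB.reg7]; ring
      · simp [g10]
      · simp [g17, hB.reg3]; omega
      · intro s hs
        rcases Nat.lt_succ_iff_lt_or_eq.mp hs with h | rfl
        · simp [g17, h.ne, gm s h]
        · simp [g17, hB.reg7]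
    · refine ⟨?_, ?_, ?_, ?_, ?_, by simp⟩
      · simp [hσ.reg0, hσ.reg8]
      · exact ((((hσ.setReg (by norm_num)).setReg (by norm_num)).setReg (by norm_num)).setReg
          (by norm_num)).setReg (by norm_num)
      · simp
      · simp [h10, hσ.reg6]
      · simp [hσ.reg4, hσ.reg8]
  · have hW : W ≤ L * (n * n) := by simpa [h9, hσ.reg5, Nat.sub_eq_zero_iff_le] using heq
    refine (Runs.const ?_ : Runs F 𝒯 _ _ 1 _).mono (by omega) fun _ h => h
    refine ⟨(hσ.setReg (by norm_num)).setReg (by norm_num), Or.inl ⟨hW, ?_, ?_, ?_⟩⟩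
    · simp [h9]
    · simp [h10]
    · simpa using hwt hW

/-- Row `j` of the matrix `μ` meets the set whose indicator vector is stored at `a`. -/
def RowCovered (n a : ℕ) (μ : ℕ → ℕ) (j : ℕ) : Prop :=
  ∃ s < n, μ (j * n + s) ≠ 0 ∧ μ (a + s) ≠ 0

theorem runs_scanCell {σ : Store} {i a d : ℕ} (hσ : σ.Base n len L inc) (h17 : σ.reg 17 = a)
    (h18 : σ.reg 18 = d) (h16 : σ.reg 16 = n - i) :
    Runs F 𝒯 .scanCell σ 8 fun σ' => σ'.Base n len L inc ∧ σ'.mem = σ.mem ∧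
      (∀ x, 9 ≤ x → x < 15 → σ'.reg x = σ.reg x) ∧ σ'.reg 16 = n - (i + 1) ∧
      σ'.reg 17 = a + 1 ∧ σ'.reg 18 = d + 1 ∧
      (σ'.reg 15 ≠ 0 ↔ σ.reg 15 ≠ 0 ∨ σ.mem d ≠ 0 ∧ σ.mem a ≠ 0) := by
  refine Runs.load_seq ?_
  refine Runs.seq (B := 4) (B' := 3) (Mid := fun σ' => σ'.Base n len L inc ∧
    σ'.mem = σ.mem ∧ (∀ x, 9 ≤ x → x ≠ 15 → x ≠ 19 → σ'.reg x = σ.reg x) ∧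
    (σ'.reg 15 ≠ 0 ↔ σ.reg 15 ≠ 0 ∨ σ.mem d ≠ 0 ∧ σ.mem a ≠ 0)) ?_ ?_
  · refine Runs.ifnz (fun hne => Runs.load_seq (Runs.ifnz (fun hne' => Runs.const ?_)
      fun heq' => Runs.const ?_)) (fun heq =>
      (Runs.const ?_ : Runs F 𝒯 _ _ 1 _).mono (by omega) fun _ h => h)
    · refine ⟨((hσ.setReg (by norm_num)).setReg (by norm_num)).setReg (by norm_num), rfl,
        fun x _ h1 h2 => by simp [h1, h2], ?_⟩
      simp only [Store.reg_setReg, Store.mem_setReg, if_true, h18, Nat.reduceEqDiff, if_false,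
        h17] at hne hne'
      simp [hne, hne']
    · refine ⟨((hσ.setReg (by norm_num)).setReg (by norm_num)).setReg (by norm_num), rfl,
        fun x _ _ h2 => by simp [h2], ?_⟩
      simp only [Store.reg_setReg, Store.mem_setReg, if_true, h18, Nat.reduceEqDiff, if_false,
        h17] at hne heq'
      simp [heq']
    · refine ⟨(hσ.setReg (by norm_num)).setReg (by norm_num), rfl,
        fun x _ _ h2 => by simp [h2], ?_⟩
      simp only [Store.reg_setReg, if_true, h18] at heq
      simp [heq]
  · rintro σ' ⟨hB, hm, hreg, hcov⟩
    refine Runs.add_seq (Runs.add_seq (Runs.sub ⟨?_, hm, fun x h1 h2 => ?_, ?_, ?_, ?_, ?_⟩))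
    · exact ((hB.setReg (by norm_num)).setReg (by norm_num)).setReg (by norm_num)
    · have h3 : x ≠ 15 := by omega
      have h4 : x ≠ 16 := by omega
      have h5 : x ≠ 17 := by omega
      have h6 : x ≠ 18 := by omega
      simp [h4, h5, h6, hreg x h1 h3 (by omega)]
    · simp [hreg 16, h16, hB.reg3]; omega
    · simp [hreg 17, h17, hB.reg3]
    · simp [hreg 18, h18, hB.reg3]
    · simpa using hcov

theorem runs_scanRow {σ : Store} {j : ℕ} (hσ : σ.Base n len L inc) (h18 : σ.reg 18 = j * n) :
    Runs F 𝒯 .scanRow σ (n * 9 + 9) fun σ' => σ'.Base n len L inc ∧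
      σ'.mem = σ.mem ∧ σ'.reg 9 = σ.reg 9 ∧ σ'.reg 10 = σ.reg 10 ∧ σ'.reg 13 = σ.reg 13 - 1 ∧
      σ'.reg 18 = (j + 1) * n ∧
      ((RowCovered n (len * n + n) σ.mem j ∧ σ'.reg 11 = σ.reg 11 ∧ σ'.reg 14 = σ.reg 14) ∨
      (¬ RowCovered n (len * n + n) σ.mem j ∧ σ'.reg 11 = 1 ∧ σ'.reg 14 = j * n)) := by
  have e : n * 9 + 9 = ((n * (8 + 1) + 1) + 4) + 1 + 1 + 1 + 1 := by omega
  rw [e]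
  refine Runs.add_seq (Runs.const_seq (Runs.add_seq (Runs.add_seq ?_)))
  refine Runs.seq (B := n * (8 + 1) + 1) (B' := 4)
    (Runs.whilenz_count (N := n) (B := 8) (J := fun i σ' => σ'.reg 16 = n - i ∧
    σ'.Base n len L inc ∧ σ'.mem = σ.mem ∧ (∀ x, 9 ≤ x → x < 15 → x ≠ 12 → σ'.reg x = σ.reg x) ∧
    σ'.reg 12 = j * n ∧ σ'.reg 17 = len * n + n + i ∧ σ'.reg 18 = j * n + i ∧
    (σ'.reg 15 ≠ 0 ↔ ∃ s < i, σ.mem (j * n + s) ≠ 0 ∧ σ.mem (len * n + n + s) ≠ 0))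
    (fun i σ' h => h.1) ?_ ?_) ?_
  · rintro i σ' hi ⟨h16, hB, hm, hreg, h12, h17, g18, h15⟩
    refine (runs_scanCell hB h17 g18 h16).mono le_rfl ?_
    rintro σ'' ⟨gB, gm, greg, g16, g17, g18, g15⟩
    refine ⟨g16, gB, gm.trans hm, fun x h1 h2 h3 => (greg x h1 h2).trans (hreg x h1 h2 h3),
      (greg 12 (by norm_num) (by norm_num)).trans h12, g17, g18, ?_⟩
    rw [g15, h15, hm]
    simp only [Nat.lt_succ_iff_lt_or_eq, or_and_right, exists_or, exists_eq_left]
  · refine ⟨?_, ?_, rfl, fun x h1 h2 h3 => ?_, ?_, ?_, ?_, ?_⟩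
    · simp [hσ.reg0, hσ.reg8]
    · exact (((hσ.setReg (by norm_num)).setReg (by norm_num)).setReg (by norm_num)).setReg
        (by norm_num)
    · have h4 : x ≠ 15 := by omega
      have h5 : x ≠ 16 := by omega
      have h6 : x ≠ 17 := by omega
      simp [h3, h4, h5, h6]
    · simp [hσ.reg8, h18]
    · simp [hσ.reg8, hσ.reg2]
    · simp [h18]
    · simp
  · rintro σ' ⟨-, hB, hm, hreg, h12, -, g18, h15⟩
    have g9 := hreg 9 (by norm_num) (by norm_num) (by norm_num)
    have g10 := hreg 10 (by norm_num) (by norm_num) (by norm_num)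
    have g11 := hreg 11 (by norm_num) (by norm_num) (by norm_num)
    have g13 := hreg 13 (by norm_num) (by norm_num) (by norm_num)
    have g14 := hreg 14 (by norm_num) (by norm_num) (by norm_num)
    have hj : j * n + n = (j + 1) * n := by ring
    refine Runs.seq (B := 3) (B' := 1) (Mid := fun σ'' => σ''.Base n len L inc ∧
      σ''.mem = σ.mem ∧ σ''.reg 9 = σ.reg 9 ∧ σ''.reg 10 = σ.reg 10 ∧ σ''.reg 13 = σ.reg 13 ∧
      σ''.reg 18 = (j + 1) * n ∧
      ((RowCovered n (len * n + n) σ.mem j ∧ σ''.reg 11 = σ.reg 11 ∧ σ''.reg 14 = σ.reg 14) ∨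
      (¬ RowCovered n (len * n + n) σ.mem j ∧ σ''.reg 11 = 1 ∧ σ''.reg 14 = j * n))) ?_ ?_
    · refine Runs.ifnz (fun hne => (Runs.const ?_ : Runs F 𝒯 _ _ 1 _).mono (by omega) fun _ h => h)
        fun heq => Runs.const_seq (Runs.add ?_)
      · refine ⟨hB.setReg (by norm_num), hm, ?_, ?_, ?_, ?_, Or.inl ⟨h15.mp hne, ?_, ?_⟩⟩
        all_goals simp [*]
      · refine ⟨(hB.setReg (by norm_num)).setReg (by norm_num), hm, ?_, ?_, ?_, ?_,
          Or.inr ⟨fun h => h15.mpr h heq, ?_, ?_⟩⟩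
        all_goals simp [g9, g10, g13, g18, hj, h12, hB.reg8]
    · rintro σ'' ⟨gB, gm, k9, k10, k13, k18, k⟩
      refine Runs.sub ⟨gB.setReg (by norm_num), gm, ?_, ?_, ?_, ?_, ?_⟩
      · simpa using k9
      · simpa using k10
      · simp [k13, gB.reg3]
      · simpa using k18
      · simpa using k

theorem runs_scan {σ : Store} (hσ : σ.Base n len L inc) :
    Runs F 𝒯 .scan σ (len * (n * 9 + 10) + 4) fun σ' => σ'.Base n len L inc ∧
      σ'.mem = σ.mem ∧ σ'.reg 9 = σ.reg 9 ∧ σ'.reg 10 = σ.reg 10 ∧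
      ((σ'.reg 11 = 0 ∧ ∀ j < len, RowCovered n (len * n + n) σ.mem j) ∨
      (σ'.reg 11 = 1 ∧ ∃ j < len, σ'.reg 14 = j * n ∧ ¬ RowCovered n (len * n + n) σ.mem j)) := by
  refine Runs.const_seq (Runs.const_seq (Runs.add_seq ?_))
  refine (Runs.whilenz_count (N := len) (B := n * 9 + 9) (J := fun j σ' => σ'.reg 13 = len - j ∧
    σ'.Base n len L inc ∧ σ'.mem = σ.mem ∧ σ'.reg 9 = σ.reg 9 ∧ σ'.reg 10 = σ.reg 10 ∧
    σ'.reg 18 = j * n ∧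
    ((σ'.reg 11 = 0 ∧ ∀ j' < j, RowCovered n (len * n + n) σ.mem j') ∨
      (σ'.reg 11 = 1 ∧ ∃ j' < j, σ'.reg 14 = j' * n ∧ ¬ RowCovered n (len * n + n) σ.mem j')))
    (fun j σ' h => h.1) ?_ ?_).mono le_rfl
    fun σ' h => ⟨h.2.1, h.2.2.1, h.2.2.2.1, h.2.2.2.2.1, h.2.2.2.2.2.2⟩
  · rintro j σ' hj ⟨h13, hB, hm, h9, h10, h18, h⟩
    refine (runs_scanRow hB h18).mono le_rfl ?_
    rintro σ'' ⟨gB, gm, g9, g10, g13, g18, g⟩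
    rw [hm] at g
    refine ⟨by rw [g13, h13, Nat.sub_sub], gB, gm.trans hm, g9.trans h9, g10.trans h10, g18, ?_⟩
    rcases g with ⟨hc, g11, g14⟩ | ⟨hc, g11, g14⟩
    · rw [g11, g14]
      rcases h with ⟨k11, k⟩ | ⟨k11, j', hj', k⟩
      · refine Or.inl ⟨k11, fun j' hj' => ?_⟩
        rcases Nat.lt_succ_iff_lt_or_eq.mp hj' with h | rfl
        exacts [k j' h, hc]
      · exact Or.inr ⟨k11, j', by omega, k⟩
    · exact Or.inr ⟨g11, j, by omega, g14, hc⟩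
  · refine ⟨?_, ((hσ.setReg (by norm_num)).setReg (by norm_num)).setReg (by norm_num), rfl,
      ?_, ?_, ?_, Or.inl ⟨?_, by simp⟩⟩
    all_goals simp [hσ.reg1, hσ.reg8]

theorem runs_doubleCell {σ : Store} {i a d : ℕ} (hσ : σ.Base n len L inc) (ha : len * n ≤ a)
    (h17 : σ.reg 17 = a) (h18 : σ.reg 18 = d) (h16 : σ.reg 16 = n - i) :
    Runs F 𝒯 .doubleCell σ 9 fun σ' => σ'.Base n len L inc ∧
      (∀ x, x ≠ a → σ'.mem x = σ.mem x) ∧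
      σ'.mem a = (if σ.mem d ≠ 0 then 2 * σ.mem a else σ.mem a) ∧
      σ'.reg 9 = σ.reg 9 + (if σ.mem d ≠ 0 then σ.mem a else 0) ∧
      σ'.reg 10 = σ.reg 10 ∧ σ'.reg 11 = σ.reg 11 ∧ σ'.reg 16 = n - (i + 1) ∧
      σ'.reg 17 = a + 1 ∧ σ'.reg 18 = d + 1 := by
  refine Runs.load_seq ?_
  refine Runs.seq (B := 5) (B' := 3) (Mid := fun σ' => σ'.Base n len L inc ∧
      (∀ x, x ≠ a → σ'.mem x = σ.mem x) ∧
      σ'.mem a = (if σ.mem d ≠ 0 then 2 * σ.mem a else σ.mem a) ∧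
      σ'.reg 9 = σ.reg 9 + (if σ.mem d ≠ 0 then σ.mem a else 0) ∧
      (∀ x, 10 ≤ x → x ≠ 19 → σ'.reg x = σ.reg x)) ?_ ?_
  · refine Runs.ifnz (fun hne => Runs.load_seq (Runs.add_seq (Runs.add_seq (Runs.store ?_))))
      (fun heq => (Runs.const ?_ : Runs F 𝒯 _ _ 1 _).mono (by omega) fun _ h => h)
    · simp only [Store.reg_setReg, if_true, h18] at hne
      refine ⟨Store.Base.setMem (by simp [h17, ha]) ((((hσ.setReg (by norm_num)).setReg
        (by norm_num)).setReg (by norm_num)).setReg (by norm_num)), fun x hx => ?_, ?_, ?_,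
        fun x h1 h2 => ?_⟩
      · simp [h17, hx]
      · simp [h17, hne]; ring
      · simp [h17, hne]
      · have h3 : x ≠ 9 := by omega
        simp [h2, h3]
    · simp only [Store.reg_setReg, if_true, h18] at heq
      refine ⟨(hσ.setReg (by norm_num)).setReg (by norm_num), fun x hx => ?_, ?_, ?_,
        fun x h1 h2 => ?_⟩
      · simp
      · simp [heq]
      · simp [heq]
      · simp [h2]
  · rintro σ' ⟨hB, hm, hma, h9, hreg⟩
    refine Runs.add_seq (Runs.add_seq (Runs.sub ⟨?_, hm, hma, ?_, ?_, ?_, ?_, ?_, ?_⟩))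
    · exact ((hB.setReg (by norm_num)).setReg (by norm_num)).setReg (by norm_num)
    · simpa using h9
    · simp [hreg]
    · simp [hreg]
    · simp [hreg, h16, hB.reg3]; omega
    · simp [hreg, h17, hB.reg3]
    · simp [hreg, h18, hB.reg3]

theorem runs_double {σ : Store} {W j : ℕ} {wt : ℕ → ℕ} (hσ : σ.Base n len L inc) (hj : j < len)
    (h9 : σ.reg 9 = W) (h11 : σ.reg 11 = 1) (h14 : σ.reg 14 = j * n)
    (hwt : ∀ s < n, σ.mem (len * n + s) = wt s) :
    Runs F 𝒯 .double σ (n * 10 + 5) fun σ' => σ'.Base n len L inc ∧ σ'.reg 10 = σ.reg 10 ∧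
      σ'.reg 11 = 1 ∧
      σ'.reg 9 = W + ∑ s ∈ Finset.range n, (if inc (j * n + s) ≠ 0 then wt s else 0) ∧
      ∀ s < n, σ'.mem (len * n + s) = if inc (j * n + s) ≠ 0 then 2 * wt s else wt s := by
  refine Runs.ifnz (fun _ => ?_) fun h => absurd h (by omega)
  refine Runs.add_seq (Runs.add_seq (Runs.add_seq ?_))
  refine (Runs.whilenz_count (N := n) (B := 9) (J := fun i σ' => σ'.reg 16 = n - i ∧
    σ'.Base n len L inc ∧ σ'.reg 10 = σ.reg 10 ∧ σ'.reg 11 = 1 ∧ σ'.reg 17 = len * n + i ∧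
    σ'.reg 18 = j * n + i ∧
    σ'.reg 9 = W + ∑ s ∈ Finset.range i, (if inc (j * n + s) ≠ 0 then wt s else 0) ∧
    (∀ s < i, σ'.mem (len * n + s) = if inc (j * n + s) ≠ 0 then 2 * wt s else wt s) ∧
    ∀ s < n, i ≤ s → σ'.mem (len * n + s) = wt s)
    (fun i σ' h => h.1) ?_ ?_).mono le_rfl
    fun σ' h => ⟨h.2.1, h.2.2.1, h.2.2.2.1, h.2.2.2.2.2.2.1, h.2.2.2.2.2.2.2.1⟩
  · rintro i σ' hi ⟨h16, hB, h10, k11, h17, h18, k9, hlt, hge⟩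
    have hd : σ'.mem (j * n + i) = inc (j * n + i) := hB.mem_eq _ (by nlinarith)
    refine (runs_doubleCell hB (by omega) h17 h18 h16).mono le_rfl ?_
    rintro σ'' ⟨gB, gm, gma, g9, g10, g11, g16, g17, g18⟩
    rw [hd, hge i hi le_rfl] at gma g9
    refine ⟨g16, gB, g10.trans h10, g11.trans k11, g17, g18, ?_, fun s hs => ?_,
      fun s hs his => ?_⟩
    · rw [g9, k9, Finset.sum_range_succ, add_assoc]
    · rcases Nat.lt_succ_iff_lt_or_eq.mp hs with h | rfl
      · rw [gm _ (by omega), hlt s h]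
      · exact gma
    · rw [gm _ (by omega), hge s hs (by omega)]
  · refine ⟨?_, ((hσ.setReg (by norm_num)).setReg (by norm_num)).setReg (by norm_num),
      ?_, ?_, ?_, ?_, ?_, by simp, fun s hs _ => by simpa using hwt s hs⟩
    all_goals simp [hσ.reg0, hσ.reg8, hσ.reg4, h11, h14, h9]

open Classical in
/-- One round of reweighting. -/
theorem runs_reweight {σ : Store} {W r : ℕ} {wt : ℕ → ℕ} (hσ : σ.Base n len L inc)
    (h9 : σ.reg 9 = W) (h10 : σ.reg 10 = r) (hwt : ∀ s < n, σ.mem (len * n + s) = wt s)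
    (hcost : ∀ T ∈ 𝒯, ∀ i, F.cost i (fun s => wt s) r ≤ T) :
    Runs F 𝒯 .reweight σ (len * (n * 9 + 10) + n * 11 + 11) fun σ' => σ'.Base n len L inc ∧
      σ'.reg 10 = r ∧ ∃ i, ∃ N, N = (F.find i (fun s => wt s) r).image Sigma.fst ∧
      ((σ'.reg 11 = 0 ∧ σ'.readSet n (len * n + n) = N ∧
        ∀ j < len, ∃ s ∈ N, inc (j * n + s) ≠ 0) ∨
      (σ'.reg 11 = 1 ∧ ∃ j < len, (¬ ∃ s ∈ N, inc (j * n + s) ≠ 0) ∧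
        σ'.reg 9 = W + ∑ s ∈ Finset.range n, (if inc (j * n + s) ≠ 0 then wt s else 0) ∧
        ∀ s < n, σ'.mem (len * n + s) = if inc (j * n + s) ≠ 0 then 2 * wt s else wt s)) := by
  have e : len * (n * 9 + 10) + n * 11 + 11 =
      (n + 2) + ((len * (n * 9 + 10) + 4) + (n * 10 + 5)) := by ring
  rw [e]
  have hread : σ.readMult n (σ.reg 4) = fun s : Fin n => wt s := by
    funext s
    rw [Store.readMult, hσ.reg4]
    exact hwt s s.2
  set N : Finset (Fin n) := (F.find σ.calls (fun s => wt s) r).image Sigma.fst with hN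
  refine Runs.seq (Mid := fun σ' => σ' = σ.writeSet (len * n + n) N) (Runs.net ?_ ?_) ?_
  · rw [hread, h10]
    exact fun T hT => hcost T hT _
  · rw [hread, h10, hσ.reg2]
  · intro σ₁ h₁
    have hB : σ₁.Base n len L inc := hσ.of_eq (fun x _ => by rw [h₁]; rfl)
      fun i hi => by rw [h₁, Store.mem_writeSet_of_lt _ _ (by omega)]
    have k9 : σ₁.reg 9 = W := by rw [h₁]; exact h9
    have k10 : σ₁.reg 10 = r := by rw [h₁]; exact h10
    have kwt : ∀ s < n, σ₁.mem (len * n + s) = wt s := fun s hs => by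
      rw [h₁, Store.mem_writeSet_of_lt _ _ (by omega), hwt s hs]
    have kN : ∀ s : Fin n, σ₁.mem (len * n + n + s) ≠ 0 ↔ s ∈ N := fun s => by
      rw [h₁, Store.mem_writeSet_add]; split_ifs with h <;> simp [h]
    have hcov : ∀ j < len, RowCovered n (len * n + n) σ₁.mem j ↔
        ∃ s ∈ N, inc (j * n + s) ≠ 0 := by
      intro j hj
      have hinc : ∀ s < n, σ₁.mem (j * n + s) = inc (j * n + s) :=
        fun s hs => hB.mem_eq _ (by nlinarith)
      constructor
      · rintro ⟨s, hs, h1, h2⟩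
        exact ⟨⟨s, hs⟩, (kN ⟨s, hs⟩).mp h2, by rw [← hinc s hs]; exact h1⟩
      · rintro ⟨s, hs, h1⟩
        exact ⟨s, s.2, by rwa [hinc s s.2], (kN s).mpr hs⟩
    refine Runs.seq (runs_scan hB) ?_
    rintro σ₂ ⟨gB, gm, g9, g10, ⟨g11, g⟩ | ⟨g11, j, hj, g14, g⟩⟩
    · refine Runs.ifnz (fun h => absurd g11 h) fun _ =>
        (Runs.const ?_ : Runs F 𝒯 _ _ 1 _).mono (by omega) fun _ h => h
      refine ⟨gB.setReg (by norm_num), by simp [g10, k10], σ.calls, N, hN, Or.inl ⟨?_, ?_, ?_⟩⟩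
      · simpa using g11
      · ext s
        rw [Store.mem_readSet, Store.mem_setReg, gm]
        exact kN s
      · exact fun j hj => (hcov j hj).mp (g j hj)
    · refine (runs_double (wt := wt) gB hj (g9.trans k9) g11 g14
        (fun s hs => by rw [gm]; exact kwt s hs)).mono le_rfl ?_
      rintro σ' ⟨f0, f10, f11, f9, fm⟩
      exact ⟨f0, f10.trans (g10.trans k10), σ.calls, N, hN,
        Or.inr ⟨f11, j, hj, fun h => g ((hcov j hj).mpr h), f9, fm⟩⟩

end Verification

end GeomCover

namespace GeomCover

section Weights

theorem one_add_inv_pow_le {c r : ℕ} (hr : 1 ≤ r) (h : 4 * c ≤ r) :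
    (1 + 1 / (r : ℝ)) ^ c ≤ 4 / 3 := by
  have hr0 : (1 : ℝ) ≤ r := by exact_mod_cast hr
  have h4 : (4 : ℝ) * c ≤ r := by exact_mod_cast h
  set x : ℝ := 1 / r with hx
  have hx0 : 0 ≤ x := by positivity
  have hx1 : x ≤ 1 := by rw [hx, div_le_one (by linarith)]; exact hr0
  have hcx : c * x ≤ 1 / 4 := by
    rw [hx, mul_one_div, div_le_iff₀ (by linarith)]
    linarith
  have h1 : 3 / 4 ≤ (1 - x) ^ c := by
    have := one_add_mul_le_pow (show (-2 : ℝ) ≤ -x by linarith) c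
    rw [← sub_eq_add_neg] at this
    linarith
  have h2 : (1 + x) ^ c * (1 - x) ^ c ≤ 1 := by
    rw [← mul_pow]
    exact pow_le_one₀ (by nlinarith) (by nlinarith)
  have h3 : 0 ≤ (1 + x) ^ c := by positivity
  nlinarith

/-- The weights `wt`, of total weight `W`, result from `L` after some number of rounds, in which
the total weight increases by at most a factor `1 + 1 / r`, and the weight of some element
of `H` is doubled. -/
def Reweighted {n : ℕ} (L r : ℕ) (H : Finset (Fin n)) (W : ℕ) (wt : ℕ → ℕ) : Prop :=
  ∃ (k : ℕ) (e : ℕ → ℕ), (∀ s < n, wt s = L * 2 ^ e s) ∧ W = ∑ s ∈ Finset.range n, wt s ∧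
    (W : ℝ) ≤ L * n * (1 + 1 / (r : ℝ)) ^ k ∧ k ≤ ∑ s ∈ H, e s

namespace Reweighted

variable {n L r W : ℕ} {H : Finset (Fin n)} {wt : ℕ → ℕ}

theorem start (h : ∀ s < n, wt s = L) : Reweighted L r H (L * n) wt := by
  refine ⟨0, fun _ => 0, fun s hs => by simp [h s hs], ?_, by simp, Nat.zero_le _⟩
  rw [Finset.sum_congr rfl fun s hs => h s (Finset.mem_range.mp hs)]
  simp [mul_comm]

theorem mul_le (h : Reweighted L r H W wt) : L * n ≤ W := by
  obtain ⟨k, e, hwt, rfl, -, -⟩ := h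
  have : ∑ s ∈ Finset.range n, L ≤ ∑ s ∈ Finset.range n, wt s :=
    Finset.sum_le_sum fun s hs => by
      rw [hwt s (Finset.mem_range.mp hs)]
      exact Nat.le_mul_of_pos_right _ (by positivity)
  simpa [mul_comm] using this

theorem pos (hL : 0 < L) (h : Reweighted L r H W wt) {s : ℕ} (hs : s < n) : 0 < wt s := by
  obtain ⟨k, e, hwt, -⟩ := h
  rw [hwt s hs]
  positivity

theorem step (h : Reweighted L r H W wt) {a : ℕ → ℕ} (hr : 1 ≤ r)
    (hlight : r * ∑ s ∈ Finset.range n, (if a s ≠ 0 then wt s else 0) ≤ W)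
    (hH : ∃ s ∈ H, a s ≠ 0) :
    Reweighted L r H (W + ∑ s ∈ Finset.range n, (if a s ≠ 0 then wt s else 0))
      (fun s => if a s ≠ 0 then 2 * wt s else wt s) := by
  obtain ⟨k, e, hwt, hW, hle, hk⟩ := h
  refine ⟨k + 1, fun s => e s + if a s ≠ 0 then 1 else 0, fun s hs => ?_, ?_, ?_, ?_⟩
  · simp only [hwt s hs]
    split_ifs <;> simp [pow_succ]; ring
  · rw [hW, ← Finset.sum_add_distrib]
    refine Finset.sum_congr rfl fun s _ => ?_
    dsimp only
    split_ifs <;> omega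
  · set d := ∑ s ∈ Finset.range n, (if a s ≠ 0 then wt s else 0)
    have hr0 : (1 : ℝ) ≤ r := by exact_mod_cast hr
    have h1 : (r : ℝ) * d ≤ W := by exact_mod_cast hlight
    have h2 : (d : ℝ) ≤ W * (1 / r) := by
      rw [mul_one_div, le_div_iff₀ (by linarith)]; linarith
    have h3 : 0 ≤ 1 / (r : ℝ) := by positivity
    push_cast
    calc (W + d : ℝ) ≤ W * (1 + 1 / r) := by linarith
      _ ≤ L * n * (1 + 1 / (r : ℝ)) ^ k * (1 + 1 / r) := by gcongr
      _ = _ := by ring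
  · obtain ⟨s, hs, has⟩ := hH
    rw [Finset.sum_add_distrib]
    refine add_le_add hk ?_
    refine le_trans ?_ (Finset.single_le_sum (f := fun s : Fin n => if a s ≠ 0 then 1 else 0)
      (fun _ _ => Nat.zero_le _) hs)
    simp [has]

theorem le_mul_sq (h : Reweighted L r H W wt) (hL : 0 < L) (hH : H.Nonempty)
    (hr : 4 * H.card ≤ r) : W ≤ L * (n * n) := by
  obtain ⟨k, e, hwt, hW, hle, hk⟩ := h
  obtain ⟨s, hs, hmax⟩ := Finset.exists_max_image H (fun s => e s) hH
  have hr1 : 1 ≤ r := by have := hH.card_pos; omega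
  have hk' : k ≤ H.card * e s := hk.trans (Finset.sum_le_card_nsmul _ _ _ hmax)
  have hL' : (0 : ℝ) < L := by exact_mod_cast hL
  have h1 : (1 + 1 / (r : ℝ)) ^ k ≤ (4 / 3) ^ e s := by
    refine (pow_le_pow_right₀ (by simp) hk').trans ?_
    rw [pow_mul]
    exact pow_le_pow_left₀ (by positivity) (one_add_inv_pow_le hr1 hr) _
  have h2 : (W : ℝ) ≤ L * n * (4 / 3) ^ e s := hle.trans (by gcongr)
  have h3 : (L * 2 ^ e s : ℝ) ≤ W := by
    have : wt s ≤ W := by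
      rw [hW]
      exact Finset.single_le_sum (f := wt) (fun _ _ => Nat.zero_le _) (Finset.mem_range.mpr s.2)
    rw [hwt s s.2] at this
    exact_mod_cast this
  have h4 : (2 : ℝ) ^ e s = (3 / 2) ^ e s * (4 / 3) ^ e s := by rw [← mul_pow]; norm_num
  have h5 : ((3 : ℝ) / 2) ^ e s ≤ n := by
    have h6 : (0 : ℝ) < (4 / 3) ^ e s := by positivity
    have h7 := h3.trans h2
    rw [h4] at h7
    have h8 : (L * (4 / 3) ^ e s : ℝ) * (3 / 2) ^ e s ≤ (L * (4 / 3) ^ e s) * n := by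
      calc _ = L * ((3 / 2) ^ e s * (4 / 3) ^ e s : ℝ) := by ring
        _ ≤ _ := h7
        _ = _ := by ring
    exact le_of_mul_le_mul_left h8 (by positivity)
  have h6 : ((4 : ℝ) / 3) ^ e s ≤ n :=
    (pow_le_pow_left₀ (by norm_num) (by norm_num) _).trans h5
  have h7 : (W : ℝ) ≤ L * (n * n) := by
    calc (W : ℝ) ≤ _ := h2
      _ ≤ L * n * n := by gcongr
      _ = _ := by ring
  exact_mod_cast h7

end Reweighted

theorem ConfigSystem.ncard_copies {n : ℕ} (m : Fin n → ℕ) (P : Fin n → Prop) [DecidablePred P] :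
    {a : Copy m | P a.1}.ncard = ∑ s, if P s then m s else 0 := by
  have h : {a : Copy m | P a.1} =
      ((Finset.univ.filter P).sigma fun _ => Finset.univ : Finset (Copy m)) := by
    ext a; simp
  rw [h, Set.ncard_coe_finset, Finset.card_sigma, Finset.sum_filter]
  simp

end Weights

section Main

variable {U : Type u} {n : ℕ} {C : ConfigSystem.{u, 0, w} U (Fin n)} {b : ℕ} {A : ℝ}
  {F : NetFinder C b A} {𝒯 : Set ℕ} {len c : ℕ} {inc : ℕ → ℕ} {H : Finset (Fin n)} {M : Set U}

/-- The net in memory covers all points, and was found with a parameter `O(c)`. -/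
def Found (C : ConfigSystem.{u, 0, w} U (Fin n)) (b : ℕ) (A : ℝ) (c len : ℕ)
    (inc : ℕ → ℕ) (σ : Store) : Prop :=
  (∀ j < len, ∃ s ∈ σ.readSet n (len * n + n), inc (j * n + s) ≠ 0) ∧
  ∃ r, r ≤ (4 + 2 * b) * c ∧
    ((σ.readSet n (len * n + n)).card : ℝ) ≤ A * max 1 (C.f r)

/-- The state of the search in the main loop, where `c'` is the current guess of the size of
the cover `H`. -/
def Searching (b len : ℕ) (H : Finset (Fin n)) (c' W : ℕ) (wt : ℕ → ℕ) (σ : Store) : Prop :=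
  σ.reg 9 = W ∧ σ.reg 10 = 4 * c' + 2 * b ∧
  ((4 + 2 * b) * (n * n) < W → c' < H.card) ∧
  (W ≤ (4 + 2 * b) * (n * n) → 1 ≤ c' ∧ c' ≤ H.card ∧
    Reweighted (4 + 2 * b) (4 * c' + 2 * b) H W wt ∧ ∀ s < n, σ.mem (len * n + s) = wt s)

/-- One round, after the weights have been checked. -/
theorem runs_reweight_of_reweighted (hrow : ∀ j < len, ∃ p ∈ M, ∀ s : Fin n,
      inc (j * n + s) ≠ 0 ↔ p ∈ C.obj s) (hH : C.IsCover M H) (hHne : H.Nonempty)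
    (hcost : ∀ T ∈ 𝒯, ∀ (j : ℕ) (m : Fin n → ℕ) (r : ℕ), 1 ≤ r → 2 * b ≤ r → r ≤ ∑ s, m s →
      r ≤ (4 + 2 * b) * H.card → ∑ s, m s ≤ (4 + 2 * b) * (n * n) → F.cost j m r ≤ T)
    {σ : Store} {c' W : ℕ} {wt : ℕ → ℕ} (hσ : σ.Base n len (4 + 2 * b) inc)
    (h9 : σ.reg 9 = W) (h10 : σ.reg 10 = 4 * c' + 2 * b) (hc1 : 1 ≤ c') (hc : c' ≤ H.card)
    (hW : W ≤ (4 + 2 * b) * (n * n)) (hre : Reweighted (4 + 2 * b) (4 * c' + 2 * b) H W wt)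
    (hwt : ∀ s < n, σ.mem (len * n + s) = wt s) :
    Runs F 𝒯 .reweight σ (len * (n * 9 + 10) + n * 11 + 11) fun σ' =>
      σ'.Base n len (4 + 2 * b) inc ∧ ((σ'.reg 11 = 0 ∧ Found C b A H.card len inc σ') ∨
      (σ'.reg 11 ≠ 0 ∧ ∃ W' wt', W < W' ∧ Searching b len H c' W' wt' σ')) := by
  classical
  set L := 4 + 2 * b with hL
  set r := 4 * c' + 2 * b with hr
  have hcn : H.card ≤ n := (Finset.card_le_univ H).trans_eq (Fintype.card_fin n)
  have hr1 : 1 ≤ r := by omega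
  have hrb : 2 * b ≤ r := by omega
  have hrc : r ≤ L * H.card := by
    rw [hr, hL]
    nlinarith
  have hsum : ∑ s : Fin n, wt s = W := by
    obtain ⟨_, _, _, hW', _⟩ := hre
    rw [hW', Finset.sum_range]
  have hrW : r ≤ ∑ s : Fin n, wt s := by
    rw [hsum]
    exact hrc.trans ((Nat.mul_le_mul_left L hcn).trans hre.mul_le)
  refine (runs_reweight hσ h9 h10 hwt fun T hT i =>
    hcost T hT i _ r hr1 hrb hrW hrc (hsum.trans_le hW)).mono le_rfl ?_
  rintro σ' ⟨gB, g10, i, N, hN, ⟨g11, gN, gcov⟩ | ⟨g11, j, hj, gcov, g9, gm⟩⟩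
  · refine ⟨gB, Or.inl ⟨g11, ?_, r, hrc, ?_⟩⟩
    · rw [gN]
      exact gcov
    · rw [gN, hN]
      exact (Nat.cast_le.mpr Finset.card_image_le).trans (F.card_le i _ r hr1 hrb hrW)
  · obtain ⟨p, hpM, hp⟩ := hrow j hj
    obtain ⟨s₀, hs₀, hps₀⟩ := hH p hpM
    have hlight : r * ∑ s ∈ Finset.range n, (if inc (j * n + s) ≠ 0 then wt s else 0) ≤ W := by
      by_contra! hlt
      have hnc : {a : ConfigSystem.Copy fun s : Fin n => wt s | p ∈ C.obj a.1}.ncard =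
          ∑ s ∈ Finset.range n, (if inc (j * n + s) ≠ 0 then wt s else 0) := by
        rw [ConfigSystem.ncard_copies _ fun s => p ∈ C.obj s, Finset.sum_range]
        exact Finset.sum_congr rfl fun s _ => if_congr (hp s).symm rfl rfl
      obtain ⟨a, ha, hpa⟩ := F.isNet i (fun s => wt s) r hr1 hrb hrW p (by
        have hr0 : (0 : ℝ) < r := by exact_mod_cast hr1
        rw [one_div, inv_mul_le_iff₀ hr0, Fintype.card_sigma]
        simp only [Fintype.card_fin]
        rw [hsum]
        have h1 : (W : ℝ) ≤
            r * (∑ s ∈ Finset.range n, (if inc (j * n + s) ≠ 0 then wt s else 0) : ℕ) := by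
          exact_mod_cast hlt.le
        rw [← hnc] at h1
        exact h1)
      refine gcov ⟨a.1, ?_, (hp a.1).mpr hpa⟩
      rw [hN]
      exact Finset.mem_image_of_mem _ ha
    have hstep := hre.step (a := fun s => inc (j * n + s)) hr1 hlight
      ⟨s₀, hs₀, (hp s₀).mpr hps₀⟩
    refine ⟨gB, Or.inr ⟨by omega, _, _, ?_, g9, g10, fun hlt => ?_,
      fun hle => ⟨hc1, hc, hstep, gm⟩⟩⟩
    · have h1 := Finset.single_le_sum
        (f := fun s => if inc (j * n + s) ≠ 0 then wt s else 0)
        (fun _ _ => Nat.zero_le _) (Finset.mem_range.mpr s₀.2)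
      have h2 := hre.pos (by omega) s₀.2
      beta_reduce at h1
      rw [if_pos ((hp s₀).mpr hps₀)] at h1
      omega
    · by_contra! hle
      exact absurd (hstep.le_mul_sq (by omega) hHne (by omega)) (not_le.mpr hlt)

theorem runs_cover (hrow : ∀ j < len, ∃ p ∈ M, ∀ s : Fin n,
      inc (j * n + s) ≠ 0 ↔ p ∈ C.obj s) (hH : C.IsCover M H) (hHne : len ≠ 0 → H.Nonempty)
    (hcost : ∀ T ∈ 𝒯, ∀ (j : ℕ) (m : Fin n → ℕ) (r : ℕ), 1 ≤ r → 2 * b ≤ r → r ≤ ∑ s, m s →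
      r ≤ (4 + 2 * b) * H.card → ∑ s, m s ≤ (4 + 2 * b) * (n * n) → F.cost j m r ≤ T)
    {σ : Store} (h0 : σ.reg 0 = n) (h1 : σ.reg 1 = len)
    (hreg : ∀ x, 2 ≤ x → σ.reg x = 0) (hmem : σ.mem = inc) :
    Runs F 𝒯 (.cover b) σ (len * 3 + n * 3 + (4 + 2 * b) * 3 + 13 +
      (n * ((4 + 2 * b) * (n * n) + 1) *
        (n * 5 + 7 + (len * (n * 9 + 10) + n * 11 + 11) + 1) + 1)) fun σ' =>
      σ'.reg 2 = len * n + n ∧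
        ((len = 0 ∧ σ'.mem = inc) ∨ Found C b A H.card len inc σ') := by
  set L := 4 + 2 * b with hL
  set thr := L * (n * n) with hthr
  refine Runs.seq (runs_setup (L := L) h0 h1 hreg fun i _ => by rw [hmem]) ?_
  rintro σ₁ ⟨hB, h9, h10, h11, hm⟩
  have hcn : H.card ≤ n := (Finset.card_le_univ H).trans_eq (Fintype.card_fin n)
  refine Runs.mono (B := H.card * (thr + 1) * _ + 1) (Runs.whilenz
    (B := n * 5 + 7 + (len * (n * 9 + 10) + n * 11 + 11))
    (I := fun k σ => σ.Base n len L inc ∧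
      ((σ.reg 11 = 0 ∧ ((len = 0 ∧ σ.mem = inc) ∨ Found C b A H.card len inc σ)) ∨
      (σ.reg 11 ≠ 0 ∧ H.Nonempty ∧ ∃ c' W wt, Searching b len H c' W wt σ ∧
        (H.card - c') * (thr + 1) + (thr + 1 - W) ≤ k)))
    ?_ ?_ ?_) (Nat.add_le_add_right (Nat.mul_le_mul_right _ (Nat.mul_le_mul_right _ hcn)) _)
    fun _ h => h
  · rintro k σ ⟨gB, ⟨g11, -⟩ | ⟨-, hne, c', W, wt, ⟨g9, g10, ghi, glo⟩, hk⟩⟩ hx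
    · exact absurd g11 hx
    refine Runs.seq (runs_checkWeight gB g9 g10 fun hle => (glo hle).2.2.2) ?_
    rintro σ' ⟨kB, hcase⟩
    obtain ⟨c'', W', wt', k9, k10, hc1, hc2, hW', hre, kwt, hdec⟩ : ∃ c'' W' wt',
        σ'.reg 9 = W' ∧ σ'.reg 10 = 4 * c'' + 2 * b ∧ 1 ≤ c'' ∧ c'' ≤ H.card ∧ W' ≤ thr ∧
        Reweighted L (4 * c'' + 2 * b) H W' wt' ∧ (∀ s < n, σ'.mem (len * n + s) = wt' s) ∧
        (H.card - c'') * (thr + 1) + (thr + 1 - W') ≤ k := by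
      rcases hcase with ⟨hle, k9, k10, kwt⟩ | ⟨hlt, k9, k10, kwt⟩
      · obtain ⟨hc1, hc2, hre, -⟩ := glo hle
        exact ⟨c', W, wt, k9, k10, hc1, hc2, hle, hre, kwt, hk⟩
      · have hlt' := ghi hlt
        refine ⟨c' + 1, L * n, fun _ => L, k9, by omega, by omega, hlt', ?_,
          Reweighted.start fun _ _ => rfl, kwt, ?_⟩
        · exact Nat.mul_le_mul_left L (Nat.le_mul_self n)
        · have h2 : H.card - c' = (H.card - (c' + 1)) + 1 := by omega
          rw [h2, add_mul] at hk
          omega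
    refine (runs_reweight_of_reweighted hrow hH hne hcost kB k9 k10 hc1 hc2 hW' hre kwt).mono
      le_rfl ?_
    rintro σ'' ⟨fB, ⟨f11, hfound⟩ | ⟨f11, W'', wt'', hlt, hsearch⟩⟩
    · exact ⟨0, by omega, fB, Or.inl ⟨f11, Or.inr hfound⟩⟩
    · exact ⟨(H.card - c'') * (thr + 1) + (thr + 1 - W''), by omega, fB,
        Or.inr ⟨f11, hne, c'', W'', wt'', hsearch, le_rfl⟩⟩
  · rintro k σ ⟨gB, ⟨-, h⟩ | ⟨g11, -⟩⟩ hx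
    · exact ⟨gB.reg2, h⟩
    · exact absurd hx g11
  · refine ⟨hB, ?_⟩
    by_cases hlen : len = 0
    · exact Or.inl ⟨h11.trans hlen, Or.inl ⟨hlen, hm.trans hmem⟩⟩
    · have := (hHne hlen).card_pos
      refine Or.inr ⟨by omega, hHne hlen, 0, thr + 1, fun _ => 0, ⟨h9, by omega, fun _ => this,
        fun h => ?_⟩, ?_⟩
      · exact absurd h (Nat.not_succ_le_self _)
      · simp

theorem input_mem_ne_zero {pts : List (Finset (Fin n))} {j : ℕ} (hj : j < pts.length)
    (s : Fin n) : (Store.input pts).mem (j * n + s) ≠ 0 ↔ s ∈ pts.get ⟨j, hj⟩ := by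
  have hn : 0 < n := s.pos
  simp only [Store.input, ne_eq, ite_eq_right_iff, one_ne_zero, imp_false, not_not]
  constructor
  · rintro ⟨j', s', h, hs'⟩
    have h1 : j = j' := by
      have := congrArg (· / n) h
      simpa [Nat.mul_comm _ n, Nat.mul_add_div hn, Nat.div_eq_of_lt s.2,
        Nat.div_eq_of_lt s'.2] using this
    subst h1
    have h2 : s = s' := Fin.ext (by omega)
    rwa [h2]
  · exact fun h => ⟨⟨j, hj⟩, s, rfl, h⟩

theorem ConfigSystem.Lists.exists_row {pts : List (Finset (Fin n))} (hpts : C.Lists M pts) {p : U}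
    (hp : p ∈ M) : ∃ j < pts.length, ∀ s : Fin n,
      (Store.input pts).mem (j * n + s) ≠ 0 ↔ p ∈ C.obj s := by
  classical
  have hmem : (Finset.univ.filter fun s => p ∈ C.obj s) ∈ pts :=
    (hpts.2 _).mpr ⟨p, hp, by simp⟩
  obtain ⟨j, hj⟩ := List.get_of_mem hmem
  refine ⟨j, j.2, fun s => ?_⟩
  rw [input_mem_ne_zero j.2, Fin.eta, hj]
  simp

theorem ConfigSystem.Lists.exists_point {pts : List (Finset (Fin n))} (hpts : C.Lists M pts)
    {j : ℕ} (hj : j < pts.length) : ∃ p ∈ M, ∀ s : Fin n,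
      (Store.input pts).mem (j * n + s) ≠ 0 ↔ p ∈ C.obj s := by
  obtain ⟨p, hp, h⟩ := (hpts.2 _).mp (List.get_mem pts ⟨j, hj⟩)
  exact ⟨p, hp, fun s => (input_mem_ne_zero hj s).trans (h s)⟩

/-- A bound for the running time. -/
noncomputable def timeBound (b D : ℕ) : Polynomial ℕ :=
  let X : Polynomial ℕ := Polynomial.X
  let l : Polynomial ℕ := D * (X + 1) ^ b
  let L : Polynomial ℕ := 4 + 2 * b
  l * 3 + X * 3 + L * 3 + 13 +
    (X * (L * (X * X) + 1) * (X * 5 + 7 + (l * (X * 9 + 10) + X * 11 + 11) + 1) + 1) +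
    L * (X * X)

theorem eval_timeBound (b D n : ℕ) : (timeBound b D).eval n =
    D * (n + 1) ^ b * 3 + n * 3 + (4 + 2 * b) * 3 + 13 +
    (n * ((4 + 2 * b) * (n * n) + 1) *
      (n * 5 + 7 + (D * (n + 1) ^ b * (n * 9 + 10) + n * 11 + 11) + 1) + 1) +
    (4 + 2 * b) * (n * n) := by
  simp [timeBound]

end Main

end GeomCover

open GeomCover in
theorem mainTheorem2 (b : ℕ) :
    -- nets of size `O(f(r))` exist, for all multisets of objects
    (∀ D : ℕ, ∃ A : ℝ, ∀ (U : Type u) (n : ℕ) (C : ConfigSystem.{u, 0, w} U (Fin n)),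
      C.IsComplete → C.DefinedByAtMost b → C.DefinesAtMost D → Nonempty (NetFinder C b A)) ∧
    -- one program turns any subroutine for such nets into a subroutine for covers
    (∃ P : Com, ∀ (D : ℕ) (A : ℝ), ∃ (K : ℝ) (Q : ℕ) (q : Polynomial ℕ),
      ∀ (U : Type u) (n : ℕ) (C : ConfigSystem.{u, 0, w} U (Fin n)),
      C.IsComplete → C.DefinedByAtMost b → C.DefinesAtMost D →
      ∀ (M : Set U) (pts : List (Finset (Fin n))), C.Lists M pts →
      ∀ (F : NetFinder C b A) (c : ℕ), (∃ H : Finset (Fin n), H.card = c ∧ C.IsCover M H) →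
      ∃ (σ : Store) (t : ℕ), Exec F P (Store.input pts) σ t ∧
        C.IsCover M (σ.output n) ∧
        ((σ.output n).card : ℝ) ≤ K * max 1 (C.f c) ∧
        ∀ T : ℕ,
          (∀ (j : ℕ) (m : Fin n → ℕ) (r : ℕ), 1 ≤ r → 2 * b ≤ r → r ≤ ∑ s, m s →
            r ≤ Q * c → ∑ s, m s ≤ q.eval n → F.cost j m r ≤ T) →
          t ≤ (T + 1) * q.eval n) := by
  refine ⟨exists_netFinder b, .cover b, fun D A => ?_⟩
  set Q := 4 + 2 * b with hQ
  set κ : ℝ := 1 + D * (Q * b + 1) ^ b + 2 ^ (2 * b * Q) * (D + 1) with hκ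
  have hκ0 : 0 ≤ κ := by positivity
  refine ⟨|A| * ((D + 1) * κ), Q, timeBound b D, ?_⟩
  rintro U n C hC hb hD M pts hpts F _ ⟨H, rfl, hH⟩
  have hlen := hpts.length_le hC hb hD
  have hq := eval_timeBound b D n
  have hK : 0 ≤ |A| * ((D + 1) * κ) * max 1 (C.f H.card) := by positivity
  obtain ⟨σ, t, hexec, ht, h2, hres⟩ := runs_cover (F := F) (len := pts.length)
    (inc := (Store.input pts).mem)
    (𝒯 := {T | ∀ (j : ℕ) (m : Fin n → ℕ) (r : ℕ), 1 ≤ r → 2 * b ≤ r → r ≤ ∑ s, m s →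
            r ≤ Q * H.card → ∑ s, m s ≤ (timeBound b D).eval n → F.cost j m r ≤ T})
    (fun j hj => hpts.exists_point hj) hH
    (fun hne => by
      obtain ⟨p, hp, -⟩ := hpts.exists_point (Nat.pos_of_ne_zero hne)
      obtain ⟨s, hs, -⟩ := hH p hp
      exact ⟨s, hs⟩)
    (fun T hT j m r h1 h2 h3 h4 h5 => hT j m r h1 h2 h3 h4 (h5.trans (by rw [hq]; omega)))
    (σ := Store.input pts) (by simp [Store.input]) (by simp [Store.input])
    (fun x hx => by
      have h0 : x ≠ 0 := by omega
      have h1 : x ≠ 1 := by omega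
      simp [Store.input, h0, h1]) rfl
  refine ⟨σ, t, hexec, ?_, ?_, fun T hT => (ht T hT).trans (Nat.mul_le_mul_left _ ?_)⟩
  · intro p hp
    obtain ⟨j, hj, hjp⟩ := hpts.exists_row hp
    rcases hres with ⟨hlen0, -⟩ | ⟨hcov, -⟩
    · omega
    · obtain ⟨s, hs, hinc⟩ := hcov j hj
      rw [Store.output, h2]
      exact ⟨s, hs, (hjp s).mp hinc⟩
  · rw [Store.output, h2]
    rcases hres with ⟨hlen0, hmem⟩ | ⟨-, r, hr, hcard⟩
    · have hnil : pts = [] := List.length_eq_zero_iff.mp hlen0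
      subst hnil
      have hempty : σ.readSet n (List.length ([] : List (Finset (Fin n))) * n + n) = ∅ := by
        ext s
        rw [Store.mem_readSet, hmem]
        simp [Store.input]
      rw [hempty]
      simpa using hK
    · have h1 : max 1 (C.f r) ≤ (D + 1) * κ * max 1 (C.f H.card) := by
        refine (ConfigSystem.f_mono_max hD hr).trans ?_
        rw [mul_assoc]
        have h3 := ConfigSystem.f_mul_le hb hD Q H.card
        exact mul_le_mul_of_nonneg_left h3 (by positivity)
      have h0 : (0 : ℝ) ≤ max 1 (C.f r) := le_trans zero_le_one (le_max_left _ _)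
      calc _ ≤ A * max 1 (C.f r) := hcard
        _ ≤ |A| * max 1 (C.f r) := mul_le_mul_of_nonneg_right (le_abs_self A) h0
        _ ≤ |A| * ((D + 1) * κ * max 1 (C.f H.card)) :=
          mul_le_mul_of_nonneg_left h1 (abs_nonneg A)
        _ = _ := by ring
  · rw [hq]
    refine le_trans ?_ (Nat.le_add_right _ _)
    gcongr
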